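/- Let $(a,b)\subset\mathbb R$ be a finite interval, $n\in\mathbb N\cup\{0\}$, $m,r\in\mathbb N=\{1,2,\dots\}$, $1\le p\le\infty$. For $k\ge 1$ let $W_p^k$ be the space of all $y\in C^{k-1}([a,b];\mathbb C)$ with $y^{(k-1)}$ absolutely continuous on $[a,b]$ and $y^{(k)}\in L_p[a,b]$, and let $W_p^0=L_p[a,b]$, with the norm $\|y\|_{k,p}=\sum_{s=0}^k\|y^{(s)}\|_p$; the norm of a vector- or matrix-valued function is the sum of the norms of its components, and the norm of a vector in $\mathbb C^{rm}$ is the sum of the moduli of its components. Let $\mathcal M$ be a metric space and $\mu_0\in\mathcal M$. For every $\mu\in\mathcal M$ let $A_0(\cdot,\mu),\dots,A_{r-1}(\cdot,\mu)\in(W_p^n)^{m\times m}$, let $B(\mu)\colon (W_p^{n+r})^m\to\mathbb C^{rm}$ be a continuous linear operator, and put $$L(\mu)y=y^{(r)}+\sum_{\ell=1}^r A_{r-\ell}(\cdot,\mu)\,y^{(r-\ell)},\qquad y\in(W_p^{n+r})^m .$$ For $f(\cdot,\mu)\in(W_p^n)^m$ and $c(\mu)\in\mathbb C^{rm}$ consider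 the boundary-value problem $$L(\mu)y=f(\cdot,\mu)\ \text{ on }(a,b),\qquad B(\mu)y=c(\mu),\tag{1}$$ whose solutions are the $y\in(W_p^{n+r})^m$ that satisfy the differential equation (everywhere on $(a,b)$ if $n\ge1$, almost everywhere if $n=0$) and the boundary condition. Assume: (0) the problem $L(\mu_0)y=0$ on $(a,b)$, $B(\mu_0)y=0$ has only the trivial solution; (I) $A_{r-\ell}(\cdot,\mu)\to A_{r-\ell}(\cdot,\mu_0)$ in $(W_p^n)^{m\times m}$ as $\mu\to\mu_0$, for every $\ell\in\{1,\dots,r\}$; (II) $B(\mu)y\to B(\mu_0)y$ in $\mathbb C^{rm}$ as $\mu\to\mu_0$, for every $y\in(W_p^{n+r})^m$. Then there exist positive numbers $\varepsilon,\gamma_1,\gamma_2$ such that, for all right-hand sides $f(\cdot,\mu)\in(W_p^n)^m$, $c(\mu)\in\mathbb C^{rm}$ ($\mu\in\mathcal M$) and every $\mu$ in the open ball $\mathcal B(\mu_0,\varepsilon)$, the problem (1) has a unique solution $y(\cdot,\mu)\in(W_p^{n+r})^m$, and $$\gamma_1\,\widetilde d_{n,p}(\mu)\le\|y(\cdot,\mu_0)-y(\cdot,\mu)\|_{n+r,p}\le\gamma_2\,\widetilde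 d_{n,p}(\mu),$$ where $$\widetilde d_{n,p}(\mu)=\|L(\mu)y(\cdot,\mu_0)-f(\cdot,\mu)\|_{n,p}+\|B(\mu)y(\cdot,\mu_0)-c(\mu)\|_{\mathbb C^{rm}} .$$ In particular $\varepsilon,\gamma_1,\gamma_2$ do not depend on $y(\cdot,\mu_0)$ or $y(\cdot,\mu)$. -/

import Mathlib

open MeasureTheory Set Filter Topology
open scoped ENNReal

namespace BVP

/-- Scalar Sobolev space `W_p^k([a,b]; ℂ)` as a predicate on functions, of which only the restriction
to `[a,b]` matters. For `k = 0` it is `L_p[a,b]`; for `k + 1` it asks that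
`y ∈ C^k[a,b]`, `y^(k) ∈ AC[a,b]` and `y^(k+1) ∈ L_p[a,b]`.
Derivatives are taken within `[a,b]` (one-sided at the end points). -/
def MemSobolev (a b : ℝ) (p : ℝ≥0∞) : ℕ → (ℝ → ℂ) → Prop
  | 0, y => MemLp y p (volume.restrict (Icc a b))
  | k + 1, y => ContDiffOn ℝ (k : ℕ) y (Icc a b) ∧
      AbsolutelyContinuousOnInterval (iteratedDerivWithin k y (Icc a b)) a b ∧
      MemLp (iteratedDerivWithin (k + 1) y (Icc a b)) p (volume.restrict (Icc a b))

/-- The Sobolev norm `∑_{s=0}^k ‖y^(s)‖_p` of a scalar function. -/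
noncomputable def sobolevNorm (a b : ℝ) (p : ℝ≥0∞) (k : ℕ) (y : ℝ → ℂ) : ℝ :=
  ∑ s ∈ Finset.range (k + 1),
    (eLpNorm (iteratedDerivWithin s y (Icc a b)) p (volume.restrict (Icc a b))).toReal

section lemmas

variable {a b : ℝ} {p : ℝ≥0∞}

theorem ac_congr (hab : a < b) {f g : ℝ → ℂ} (h : EqOn f g (Icc a b))
    (hf : AbsolutelyContinuousOnInterval f a b) : AbsolutelyContinuousOnInterval g a b := by
  rw [absolutelyContinuousOnInterval_iff] at hf ⊢
  intro ε hε
  obtain ⟨δ, hδ, H⟩ := hf ε hε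
  refine ⟨δ, hδ, fun E hE hs => ?_⟩
  have := H E hE hs
  refine lt_of_eq_of_lt (Finset.sum_congr rfl fun i hi => ?_) this
  have h1 := hE.1 i hi
  rw [uIcc_of_le hab.le] at h1
  rw [h h1.1, h h1.2]

theorem ac_ae_diff (hab : a < b) {f : ℝ → ℂ} (hf : AbsolutelyContinuousOnInterval f a b) :
    ∀ᵐ t ∂(volume.restrict (Icc a b)), DifferentiableWithinAt ℝ f (Icc a b) t := by
  rw [ae_restrict_iff' measurableSet_Icc]
  filter_upwards [hf.boundedVariationOn.ae_differentiableAt_of_mem_uIcc] with t ht hm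
  rw [uIcc_of_le hab.le] at ht
  exact (ht hm).differentiableWithinAt

theorem memLp_of_continuousOn {f : ℝ → ℂ} (hf : ContinuousOn f (Icc a b)) :
    MemLp f p (volume.restrict (Icc a b)) := by
  obtain ⟨C, hC⟩ := isCompact_Icc.exists_bound_of_continuousOn hf
  refine MemLp.of_bound (hf.aestronglyMeasurable measurableSet_Icc) C ?_
  rw [ae_restrict_iff' measurableSet_Icc]
  exact ae_of_all _ hC

theorem memSobolev_succ_succ (hab : a < b) {k : ℕ} {y : ℝ → ℂ} :
    MemSobolev a b p (k + 2) y ↔ DifferentiableOn ℝ y (Icc a b) ∧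
      MemSobolev a b p (k + 1) (derivWithin y (Icc a b)) := by
  have h := contDiffOn_succ_iff_derivWithin (n := ((k : ℕ) : WithTop ℕ∞)) (f := y)
    (uniqueDiffOn_Icc hab)
  simp only [MemSobolev, ← iteratedDerivWithin_succ']
  push_cast
  rw [h]
  simp
  tauto

theorem MemSobolev.mono (hab : a < b) {k : ℕ} {y : ℝ → ℂ} (h : MemSobolev a b p (k + 1) y) :
    MemSobolev a b p k y := by
  cases k with
  | zero =>
    refine memLp_of_continuousOn ?_
    simpa using h.1.continuousOn
  | succ k =>
    obtain ⟨h1, h2, h3⟩ := h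
    have h4 := (contDiffOn_nat_succ_iff_contDiffOn_one_iteratedDerivWithin
      (uniqueDiffOn_Icc hab)).1 h1
    refine ⟨h4.1, ?_, ?_⟩
    · refine ContDiffOn.absolutelyContinuousOnInterval ?_
      rw [uIcc_of_le hab.le]
      exact h4.2
    · refine memLp_of_continuousOn ?_
      have := h2.continuousOn
      rwa [uIcc_of_le hab.le] at this

theorem MemSobolev.mono_add (hab : a < b) {k : ℕ} (j : ℕ) {y : ℝ → ℂ}
    (h : MemSobolev a b p (k + j) y) : MemSobolev a b p k y := by
  induction j with
  | zero => exact h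
  | succ j ih => exact ih (MemSobolev.mono hab h)

theorem MemSobolev.derivWithin (hab : a < b) {k : ℕ} {y : ℝ → ℂ}
    (h : MemSobolev a b p (k + 1) y) : MemSobolev a b p k (derivWithin y (Icc a b)) := by
  cases k with
  | zero => simpa [MemSobolev] using h.2.2
  | succ k => exact ((memSobolev_succ_succ hab).1 h).2

theorem MemSobolev.iteratedDerivWithin (hab : a < b) {k : ℕ} (j : ℕ) {y : ℝ → ℂ}
    (h : MemSobolev a b p (k + j) y) :
    MemSobolev a b p k (iteratedDerivWithin j y (Icc a b)) := by
  induction j generalizing y with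
  | zero => simpa using h
  | succ j ih =>
    rw [iteratedDerivWithin_succ']
    exact ih (MemSobolev.derivWithin hab h)

theorem MemSobolev.memLp (hab : a < b) {k s : ℕ} (hs : s ≤ k) {y : ℝ → ℂ}
    (h : MemSobolev a b p k y) :
    MemLp (_root_.iteratedDerivWithin s y (Icc a b)) p (volume.restrict (Icc a b)) := by
  obtain ⟨d, rfl⟩ := Nat.exists_eq_add_of_le hs
  rw [add_comm] at h
  have := MemSobolev.iteratedDerivWithin hab s h
  exact MemSobolev.mono_add hab (k := 0) d (by simpa using this)

theorem iteratedDerivWithin_add_ae (hab : a < b) {k s : ℕ} (hs : s ≤ k) {y z : ℝ → ℂ}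
    (hy : MemSobolev a b p k y) (hz : MemSobolev a b p k z) :
    _root_.iteratedDerivWithin s (y + z) (Icc a b) =ᵐ[volume.restrict (Icc a b)]
      _root_.iteratedDerivWithin s y (Icc a b) + _root_.iteratedDerivWithin s z (Icc a b) := by
  obtain ⟨d, rfl⟩ := Nat.exists_eq_add_of_le hs
  replace hy := hy.mono_add hab
  replace hz := hz.mono_add hab
  cases s with
  | zero => simp
  | succ s =>
    have key : EqOn (_root_.iteratedDerivWithin s (y + z) (Icc a b))
      (_root_.iteratedDerivWithin s y (Icc a b) + _root_.iteratedDerivWithin s z (Icc a b))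
      (Icc a b) := fun t ht => iteratedDerivWithin_add ht (uniqueDiffOn_Icc hab)
        (hy.1 t ht) (hz.1 t ht)
    have hm : ∀ᵐ t ∂(volume.restrict (Icc a b)), t ∈ Icc a b := ae_restrict_mem measurableSet_Icc
    filter_upwards [ac_ae_diff hab hy.2.1, ac_ae_diff hab hz.2.1, hm] with t h1 h2 ht
    simp only [Pi.add_apply, iteratedDerivWithin_succ]
    rw [derivWithin_congr key (key ht), derivWithin_add h1 h2]

theorem iteratedDerivWithin_smul_all (s : ℕ) (c : ℂ) (y : ℝ → ℂ) :
    _root_.iteratedDerivWithin s (c • y) (Icc a b) =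
      c • _root_.iteratedDerivWithin s y (Icc a b) := by
  induction s generalizing y with
  | zero => simp
  | succ s ih =>
    rw [iteratedDerivWithin_succ, iteratedDerivWithin_succ, ih]
    ext t
    simp only [Pi.smul_apply]
    exact derivWithin_const_smul_field c _

theorem MemSobolev.add (hab : a < b) {k : ℕ} {y z : ℝ → ℂ}
    (hy : MemSobolev a b p k y) (hz : MemSobolev a b p k z) : MemSobolev a b p k (y + z) := by
  cases k with
  | zero => exact MemLp.add hy hz
  | succ k =>
    refine ⟨hy.1.add hz.1, ac_congr hab ?_ (hy.2.1.add hz.2.1),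
      (memLp_congr_ae (iteratedDerivWithin_add_ae hab le_rfl hy hz)).2 (hy.2.2.add hz.2.2)⟩
    exact fun t ht => (iteratedDerivWithin_add ht (uniqueDiffOn_Icc hab)
        (hy.1 t ht) (hz.1 t ht)).symm

theorem MemSobolev.smul {k : ℕ} (c : ℂ) {y : ℝ → ℂ}
    (hy : MemSobolev a b p k y) : MemSobolev a b p k (c • y) := by
  cases k with
  | zero => exact MemLp.const_smul hy c
  | succ k =>
    refine ⟨contDiffOn_const.smul hy.1, ?_, ?_⟩
    · rw [iteratedDerivWithin_smul_all]
      exact hy.2.1.const_smul c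
    · rw [iteratedDerivWithin_smul_all]
      exact hy.2.2.const_smul c

theorem MemSobolev.congr (hab : a < b) {k : ℕ} {y z : ℝ → ℂ} (h : EqOn y z (Icc a b))
    (hy : MemSobolev a b p k y) : MemSobolev a b p k z := by
  have hI : ∀ s, EqOn (_root_.iteratedDerivWithin s y (Icc a b))
      (_root_.iteratedDerivWithin s z (Icc a b)) (Icc a b) :=
    fun s => iteratedDerivWithin_congr h
  have hL : ∀ {f g : ℝ → ℂ}, EqOn f g (Icc a b) → MemLp f p (volume.restrict (Icc a b)) →
      MemLp g p (volume.restrict (Icc a b)) := by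
    intro f g hfg hf
    refine (memLp_congr_ae ?_).1 hf
    filter_upwards [ae_restrict_mem measurableSet_Icc] with t ht using hfg ht
  cases k with
  | zero => exact hL h hy
  | succ k => exact ⟨hy.1.congr fun t ht => (h ht).symm, ac_congr hab (hI k) hy.2.1,
      hL (hI _) hy.2.2⟩

theorem MemSobolev.mul (hab : a < b) {n : ℕ} {f g : ℝ → ℂ}
    (hf : MemSobolev a b p n f) (hg : MemSobolev a b p (n + 1) g) :
    MemSobolev a b p n (f * g) := by
  have bdd : ∀ {u v : ℝ → ℂ}, MemLp u p (volume.restrict (Icc a b)) → ContinuousOn v (Icc a b) →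
      MemLp (u * v) p (volume.restrict (Icc a b)) := by
    intro u v hu hv
    exact MemLp.mul (p := p) (q := ⊤) (r := p) (memLp_of_continuousOn hv) hu
  have hm : ∀ᵐ t ∂(volume.restrict (Icc a b)), t ∈ Icc a b := ae_restrict_mem measurableSet_Icc
  induction n generalizing f g with
  | zero => exact bdd hf (by simpa using hg.1.continuousOn)
  | succ n ih =>
    have hg' := hg.mono hab
    cases n with
    | zero =>
      have fc : ContinuousOn f (Icc a b) := by simpa using hf.1.continuousOn
      have gc : ContinuousOn g (Icc a b) := by simpa using hg.1.continuousOn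
      have hfa : AbsolutelyContinuousOnInterval f a b := by simpa using hf.2.1
      have hga : AbsolutelyContinuousOnInterval g a b := by simpa using hg'.2.1
      refine ⟨by simpa using fc.mul gc, by simpa using hfa.smul hga, ?_⟩
      have h1 : MemLp (_root_.derivWithin f (Icc a b)) p (volume.restrict (Icc a b)) := by
        simpa using hf.2.2
      have h2 : MemLp (_root_.derivWithin g (Icc a b)) p (volume.restrict (Icc a b)) := by
        simpa using hg'.2.2
      have e : _root_.iteratedDerivWithin (0 + 1) (f * g) (Icc a b)
          =ᵐ[volume.restrict (Icc a b)]
          _root_.derivWithin f (Icc a b) * g + _root_.derivWithin g (Icc a b) * f := by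
        filter_upwards [ac_ae_diff hab hfa, ac_ae_diff hab hga] with t d1 d2
        simp only [zero_add, iteratedDerivWithin_one, Pi.add_apply, Pi.mul_apply]
        rw [derivWithin_mul d1 d2]
        ring
      exact (memLp_congr_ae e).2 ((bdd h1 gc).add (bdd h2 fc))
    | succ n =>
      have df := ((memSobolev_succ_succ hab).1 hf)
      have dg := ((memSobolev_succ_succ hab).1 hg)
      refine (memSobolev_succ_succ hab).2 ⟨df.1.mul dg.1, ?_⟩
      have hs := (ih df.2 hg').add hab (ih (hg'.derivWithin hab) hf)
      refine hs.congr hab fun t ht => ?_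
      simp only [Pi.add_apply, Pi.mul_apply]
      rw [derivWithin_mul (df.1 t ht) (dg.1 t ht)]
      ring

theorem memSobolev_zero (hab : a < b) (k : ℕ) : MemSobolev a b p k 0 := by
  have h : ∀ s, _root_.iteratedDerivWithin s (0 : ℝ → ℂ) (Icc a b) = 0 := by
    intro s
    simpa using iteratedDerivWithin_smul_all s 0 0
  cases k with
  | zero => exact MemLp.zero
  | succ k =>
    refine ⟨contDiffOn_const, ?_, ?_⟩
    · rw [h]
      exact ContDiffOn.absolutelyContinuousOnInterval contDiffOn_const
    · rw [h]
      exact MemLp.zero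

theorem sobolevNorm_nonneg (k : ℕ) (y : ℝ → ℂ) : 0 ≤ sobolevNorm a b p k y :=
  Finset.sum_nonneg fun _ _ => ENNReal.toReal_nonneg

theorem sobolevNorm_smul (k : ℕ) (c : ℂ) (y : ℝ → ℂ) :
    sobolevNorm a b p k (c • y) = ‖c‖ * sobolevNorm a b p k y := by
  simp only [sobolevNorm, iteratedDerivWithin_smul_all, Finset.mul_sum, eLpNorm_const_smul,
    ENNReal.toReal_mul, toReal_enorm]

theorem sobolevNorm_add_le (hab : a < b) (hp : 1 ≤ p) {k : ℕ} {y z : ℝ → ℂ}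
    (hy : MemSobolev a b p k y) (hz : MemSobolev a b p k z) :
    sobolevNorm a b p k (y + z) ≤ sobolevNorm a b p k y + sobolevNorm a b p k z := by
  rw [sobolevNorm, sobolevNorm, sobolevNorm, ← Finset.sum_add_distrib]
  refine Finset.sum_le_sum fun s hs => ?_
  have hs' : s ≤ k := Nat.lt_succ_iff.1 (Finset.mem_range.1 hs)
  have h1 := hy.memLp hab hs'
  have h2 := hz.memLp hab hs'
  rw [eLpNorm_congr_ae (iteratedDerivWithin_add_ae hab hs' hy hz),
    ← ENNReal.toReal_add h1.2.ne h2.2.ne]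
  exact ENNReal.toReal_mono (ENNReal.add_ne_top.2 ⟨h1.2.ne, h2.2.ne⟩)
    (eLpNorm_add_le h1.1 h2.1 hp)

end lemmas

section space

variable {a b : ℝ}

/-- Functions on `[a,b]` with a finite family of complex components, all in `W_p^k`. -/
def sobolevSubmodule (hab : a < b) (k : ℕ) (p : ℝ≥0∞) (ι : Type*) :
    Submodule ℂ (ℝ → ι → ℂ) where
  carrier := {y | ∀ i, MemSobolev a b p k (fun t => y t i)}
  add_mem' hy hz i := (hy i).add hab (hz i)
  zero_mem' _ := memSobolev_zero hab k
  smul_mem' c _ hy i := (hy i).smul c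

/-- The Sobolev space `W_p^k([a,b]; ℂ^ι)`; vectors for `ι = Fin m`, `m × m` matrices for
`ι = Fin m × Fin m`. Its elements are represented by functions on `ℝ`; two representatives are at
distance `0` iff they agree on `[a,b]` (almost everywhere, if `k = 0`). -/
def SobolevSpace (hab : a < b) (k : ℕ) (p : ℝ≥0∞) (ι : Type*) : Type _ :=
  sobolevSubmodule hab k p ι

variable {hab : a < b} {k : ℕ} {p : ℝ≥0∞} {ι : Type*}

instance : CoeFun (SobolevSpace hab k p ι) (fun _ => ℝ → ι → ℂ) := ⟨fun y => y.1⟩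

instance : AddCommGroup (SobolevSpace hab k p ι) :=
  inferInstanceAs (AddCommGroup (sobolevSubmodule hab k p ι))

instance : Module ℂ (SobolevSpace hab k p ι) :=
  inferInstanceAs (Module ℂ (sobolevSubmodule hab k p ι))

/-- The norm is the sum of the Sobolev norms of the components. -/
noncomputable instance [Fintype ι] : Norm (SobolevSpace hab k p ι) :=
  ⟨fun y => ∑ i, sobolevNorm a b p k (fun t => y t i)⟩

theorem sobolevSpace_core [Fintype ι] [hp : Fact (1 ≤ p)] :
    SeminormedSpace.Core ℂ (SobolevSpace hab k p ι) where
  norm_nonneg y := Finset.sum_nonneg fun _ _ => sobolevNorm_nonneg _ _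
  norm_smul c y := by
    change ∑ i, sobolevNorm a b p k (c • fun t => y t i) = ‖c‖ * ∑ i, _
    rw [Finset.mul_sum]
    exact Finset.sum_congr rfl fun i _ => sobolevNorm_smul k c _
  norm_triangle y z := by
    change ∑ i, sobolevNorm a b p k ((fun t => y t i) + fun t => z t i) ≤ (∑ i, _) + ∑ i, _
    rw [← Finset.sum_add_distrib]
    exact Finset.sum_le_sum fun i _ => sobolevNorm_add_le hab hp.out (y.2 i) (z.2 i)

noncomputable instance [Fintype ι] [Fact (1 ≤ p)] :
    SeminormedAddCommGroup (SobolevSpace hab k p ι) :=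
  SeminormedAddCommGroup.ofCore sobolevSpace_core

noncomputable instance [Fintype ι] [Fact (1 ≤ p)] : NormedSpace ℂ (SobolevSpace hab k p ι) where
  norm_smul_le c y := (sobolevSpace_core.norm_smul c y).le

end space

section problem

variable {a b : ℝ} {hab : a < b} {n m r : ℕ} {p : ℝ≥0∞}

/-- `ℂ^d`, with the sum of the moduli of the components as norm. -/
abbrev CVec (d : ℕ) : Type := PiLp 1 (fun _ : Fin d => ℂ)

/-- The differential expression `L y = y^(r) + ∑_{j < r} A_j y^(j)`, from `(W_p^{n+r})^m` to
`(W_p^n)^m`. -/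
noncomputable def diffOp (A : Fin r → SobolevSpace hab n p (Fin m × Fin m))
    (y : SobolevSpace hab (n + r) p (Fin m)) : SobolevSpace hab n p (Fin m) :=
  ⟨fun t i => iteratedDerivWithin r (fun τ => y τ i) (Icc a b) t +
      ∑ j : Fin r, ∑ l : Fin m,
        A j t (i, l) * iteratedDerivWithin j (fun τ => y τ l) (Icc a b) t, by
    have hterm : ∀ (i : Fin m) (j : Fin r) (l : Fin m), MemSobolev a b p n
        ((fun t => A j t (i, l)) * iteratedDerivWithin j (fun τ => y τ l) (Icc a b)) := by
      intro i j l
      refine ((A j).2 (i, l)).mul hab ?_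
      refine MemSobolev.mono_add hab (r - 1 - j) (MemSobolev.iteratedDerivWithin hab j ?_)
      have := y.2 l
      have hj := j.2
      rwa [show n + 1 + (r - 1 - (j : ℕ)) + j = n + r by omega]
    have hsum : ∀ (i : Fin m), MemSobolev a b p n (fun t => ∑ j : Fin r, ∑ l : Fin m,
        A j t (i, l) * iteratedDerivWithin j (fun τ => y τ l) (Icc a b) t) := by
      intro i
      have hmem : ∀ (κ : Type) (s : Finset κ) (F : κ → ℝ → ℂ),
          (∀ x ∈ s, MemSobolev a b p n (F x)) → MemSobolev a b p n (fun t => ∑ x ∈ s, F x t) := by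
        intro κ s F hF
        classical
        induction s using Finset.induction_on with
        | empty =>
          simp only [Finset.sum_empty]
          exact memSobolev_zero hab n
        | insert x s hx ih =>
          simp only [Finset.sum_insert hx]
          exact (hF x (by simp)).add hab (ih fun z hz => hF z (by simp [hz]))
      exact hmem _ _ _ fun j _ => hmem _ _ _ fun l _ => hterm i j l
    exact fun i => (MemSobolev.iteratedDerivWithin hab r (y.2 i)).add hab (hsum i)⟩

variable [Fact (1 ≤ p)]

/-- `y ∈ (W_p^{n+r})^m` solves `L y = f` on `(a,b)` (everywhere if `n ≥ 1`, almost everywhere if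
`n = 0`) and `B y = c`. -/
def IsSolution (A : Fin r → SobolevSpace hab n p (Fin m × Fin m))
    (B : SobolevSpace hab (n + r) p (Fin m) →L[ℂ] CVec (r * m))
    (f : SobolevSpace hab n p (Fin m)) (c : CVec (r * m))
    (y : SobolevSpace hab (n + r) p (Fin m)) : Prop :=
  (1 ≤ n → ∀ t ∈ Ioo a b, diffOp A y t = f t) ∧
  (n = 0 → ∀ᵐ t, t ∈ Ioo a b → diffOp A y t = f t) ∧
  B y = c

/-- The homogeneous problem `L y = 0`, `B y = 0` has only the trivial solution. -/
def ConditionZero (A : Fin r → SobolevSpace hab n p (Fin m × Fin m))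
    (B : SobolevSpace hab (n + r) p (Fin m) →L[ℂ] CVec (r * m)) : Prop :=
  ∀ y, IsSolution A B 0 0 y → ∀ t ∈ Icc a b, y t = 0

variable {M : Type*} [MetricSpace M]

/-- Convergence of the coefficients, `A_j(·,μ) → A_j(·,μ₀)` in `(W_p^n)^{m×m}` as `μ → μ₀`. -/
def LimitConditionI (A : M → Fin r → SobolevSpace hab n p (Fin m × Fin m)) (μ₀ : M) : Prop :=
  ∀ j, Tendsto (fun μ => A μ j) (𝓝 μ₀) (𝓝 (A μ₀ j))

/-- Strong convergence of the boundary operators, `B(μ) y → B(μ₀) y` in `ℂ^{rm}` for every `y`. -/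
def LimitConditionII (B : M → SobolevSpace hab (n + r) p (Fin m) →L[ℂ] CVec (r * m))
    (μ₀ : M) : Prop :=
  ∀ y, Tendsto (fun μ => B μ y) (𝓝 μ₀) (𝓝 (B μ₀ y))

/-- The discrepancy `‖L y₀ - f‖_{n,p} + ‖B y₀ - c‖`. -/
noncomputable def discrepancy (A : Fin r → SobolevSpace hab n p (Fin m × Fin m))
    (B : SobolevSpace hab (n + r) p (Fin m) →L[ℂ] CVec (r * m))
    (f : SobolevSpace hab n p (Fin m)) (c : CVec (r * m))
    (y₀ : SobolevSpace hab (n + r) p (Fin m)) : ℝ :=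
  ‖diffOp A y₀ - f‖ + ‖B y₀ - c‖

end problem

end BVP

open BVP

/-! Put T(μ) = (L(μ), B(μ)), acting from (W_p^{n+r})^m to (W_p^n)^m × ℂ^{rm}. If y solves (1), then
f(μ) = L(μ)y and c(μ) = B(μ)y, so the discrepancy is exactly ‖L(μ)(y₀ - y)‖ + ‖B(μ)(y₀ - y)‖.
Everything therefore reduces to showing that, near μ₀, T(μ) is onto and ‖T(μ)y‖ is comparable to ‖y‖
with constants independent of μ; right-hand sides play no role in the constants.

At μ₀, T(μ₀) is bijective: the Cauchy problem for L(μ₀) is solvable for all data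
(`exists_cauchy_solution`), so L(μ₀) is onto and its kernel contains rm independent elements.
Condition (0) makes B(μ₀) injective on the kernel, and a dimension count gives surjectivity of the
pair (`surjective_prod_of_injective`).

Near μ₀, L(μ) converges in operator norm, by the multiplication estimate W_p^n · W_p^{n+1} ⊂ W_p^n
(`exists_norm_diffOp_sub_le`), but B(μ) converges only strongly, so T(μ) need not converge in norm.
With R = T(μ₀)⁻¹, the operator T(μ)R is nevertheless norm-close to a block triangular operator with
identity diagonal and corner β(μ)f = B(μ)R(f, 0). The corner is bounded by Banach–Steinhaus, which
bounds the inverse of the triangular operator. The block B(μ)R(0, ·) does tend to the identity in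
norm, since ℂ^{rm} is finite dimensional. A Neumann series finishes the argument
(`exists_uniform_bound_of_bijective`).

Elements are functions on ℝ, so the spaces are only seminormed; separation quotients absorb the
ambiguity. -/

namespace BVP

/-! ### Primitives and absolute continuity. -/

section calculus

variable {a b : ℝ} {p : ℝ≥0∞}

theorem ac_of_dist_le {X Y : Type*} [PseudoMetricSpace X] [PseudoMetricSpace Y] {f : ℝ → X}
    {g : ℝ → Y} (h : ∀ s ∈ uIcc a b, ∀ t ∈ uIcc a b, dist (f s) (f t) ≤ dist (g s) (g t))
    (hg : AbsolutelyContinuousOnInterval g a b) : AbsolutelyContinuousOnInterval f a b := by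
  rw [absolutelyContinuousOnInterval_iff] at hg ⊢
  intro ε hε
  obtain ⟨δ, hδ, H⟩ := hg ε hε
  refine ⟨δ, hδ, fun E hE hs => (Finset.sum_le_sum fun i hi => ?_).trans_lt (H E hE hs)⟩
  exact h _ (hE.1 i hi).1 _ (hE.1 i hi).2

theorem intervalIntegrable_of_mem {E : Type*} [NormedAddCommGroup E] {f : ℝ → E}
    (hf : IntegrableOn f (Icc a b)) {s t : ℝ} (hs : s ∈ Icc a b) (ht : t ∈ Icc a b) :
    IntervalIntegrable f volume s t :=
  intervalIntegrable_iff.2 (hf.mono_set (uIoc_subset_uIcc.trans (uIcc_subset_Icc hs ht)))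

/-- The increments are dominated by those of the real primitive of ‖f‖, which is absolutely
continuous. -/
theorem ac_primitive {E : Type*} [NormedAddCommGroup E] [NormedSpace ℝ E] (hab : a < b)
    {f : ℝ → E} (hf : IntegrableOn f (Icc a b)) (c : E) :
    AbsolutelyContinuousOnInterval (fun t => c + ∫ s in a..t, f s) a b := by
  have ha : a ∈ Icc a b := left_mem_Icc.2 hab.le
  have hn : IntervalIntegrable (fun s => ‖f s‖) volume a b :=
    intervalIntegrable_of_mem hf.norm ha (right_mem_Icc.2 hab.le)
  refine ac_of_dist_le ?_
    (hn.absolutelyContinuousOnInterval_intervalIntegral (left_mem_uIcc (a := a) (b := b)))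
  intro s hs t ht
  rw [uIcc_of_le hab.le] at hs ht
  rw [dist_add_left, dist_eq_norm, dist_eq_norm, intervalIntegral.integral_interval_sub_left
    (intervalIntegrable_of_mem hf ha hs) (intervalIntegrable_of_mem hf ha ht),
    intervalIntegral.integral_interval_sub_left
    (intervalIntegrable_of_mem hf.norm ha hs) (intervalIntegrable_of_mem hf.norm ha ht)]
  exact intervalIntegral.norm_integral_le_abs_integral_norm

theorem derivWithin_primitive_ae (hab : a < b)
    {f : ℝ → ℂ} (hf : IntegrableOn f (Icc a b)) (c : ℂ) :
    derivWithin (fun t => c + ∫ s in a..t, f s) (Icc a b) =ᵐ[volume.restrict (Icc a b)] f := by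
  have hi : IntervalIntegrable f volume a b :=
    intervalIntegrable_of_mem hf (left_mem_Icc.2 hab.le) (right_mem_Icc.2 hab.le)
  rw [Filter.EventuallyEq, ae_restrict_iff' measurableSet_Icc]
  filter_upwards [hi.ae_hasDerivAt_integral] with t ht hm
  rw [uIcc_of_le hab.le] at ht
  exact ((ht hm a (left_mem_Icc.2 hab.le)).const_add c).hasDerivWithinAt.derivWithin
    (uniqueDiffOn_Icc hab t hm)

theorem hasDerivWithinAt_primitive (hab : a < b)
    {f : ℝ → ℂ} (hf : ContinuousOn f (Icc a b)) (c : ℂ) {t : ℝ} (ht : t ∈ Icc a b) :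
    HasDerivWithinAt (fun t => c + ∫ s in a..t, f s) (f t) (Icc a b) t := by
  have : Fact (t ∈ Icc a b) := ⟨ht⟩
  refine HasDerivWithinAt.const_add c ?_
  exact intervalIntegral.integral_hasDerivWithinAt_right
    (intervalIntegrable_of_mem (hf.integrableOn_compact isCompact_Icc) (left_mem_Icc.2 hab.le) ht)
    (hf.stronglyMeasurableAtFilter_nhdsWithin measurableSet_Icc t) (hf t ht)

theorem memLp_integrableOn {f : ℝ → ℂ} (hp : 1 ≤ p) (hf : MemLp f p (volume.restrict (Icc a b))) :
    IntegrableOn f (Icc a b) :=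
  hf.integrable hp

theorem MemSobolev.toMemLp (hab : a < b) {k : ℕ} {f : ℝ → ℂ} (hf : MemSobolev a b p k f) :
    MemLp f p (volume.restrict (Icc a b)) := by
  simpa using hf.memLp hab (Nat.zero_le k)

theorem MemSobolev.toIntegrableOn (hab : a < b) (hp : 1 ≤ p) {k : ℕ} {f : ℝ → ℂ}
    (hf : MemSobolev a b p k f) : IntegrableOn f (Icc a b) :=
  memLp_integrableOn hp (hf.toMemLp hab)

theorem MemSobolev.toContinuousOn {k : ℕ} {f : ℝ → ℂ}
    (hf : MemSobolev a b p (k + 1) f) : ContinuousOn f (Icc a b) :=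
  hf.1.continuousOn

theorem memSobolev_one {f : ℝ → ℂ} : MemSobolev a b p 1 f ↔ ContinuousOn f (Icc a b) ∧
    AbsolutelyContinuousOnInterval f a b ∧
      MemLp (derivWithin f (Icc a b)) p (volume.restrict (Icc a b)) := by
  simp [MemSobolev]

theorem MemSobolev.ae_differentiableWithinAt (hab : a < b) {k : ℕ} {f : ℝ → ℂ}
    (hf : MemSobolev a b p (k + 1) f) :
    ∀ᵐ t ∂(volume.restrict (Icc a b)), DifferentiableWithinAt ℝ f (Icc a b) t := by
  rw [add_comm] at hf
  exact ac_ae_diff hab (memSobolev_one.1 (hf.mono_add hab k)).2.1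

theorem memSobolev_one_of_ac (hab : a < b) {f g : ℝ → ℂ}
    (hf : AbsolutelyContinuousOnInterval f a b)
    (hg : MemLp g p (volume.restrict (Icc a b)))
    (h : derivWithin f (Icc a b) =ᵐ[volume.restrict (Icc a b)] g) : MemSobolev a b p 1 f := by
  refine memSobolev_one.2 ⟨?_, hf, (memLp_congr_ae h).2 hg⟩
  simpa [uIcc_of_le hab.le] using hf.continuousOn

/-- Each integration gains one derivative; this drives both completeness and the regularity of
Cauchy solutions. -/
theorem memSobolev_primitive (hab : a < b) (hp : 1 ≤ p) {k : ℕ} {f : ℝ → ℂ}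
    (hf : MemSobolev a b p k f) (c : ℂ) :
    MemSobolev a b p (k + 1) (fun t => c + ∫ s in a..t, f s) := by
  have hi := hf.toIntegrableOn hab hp
  cases k with
  | zero =>
    exact memSobolev_one_of_ac hab (ac_primitive hab hi c) hf (derivWithin_primitive_ae hab hi c)
  | succ k =>
    have hc := hf.toContinuousOn
    refine (memSobolev_succ_succ hab).2
      ⟨fun t ht => (hasDerivWithinAt_primitive hab hc c ht).differentiableWithinAt, ?_⟩
    refine hf.congr hab fun t ht => ?_
    exact ((hasDerivWithinAt_primitive hab hc c ht).derivWithin (uniqueDiffOn_Icc hab t ht)).symm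

/-- The difference of the two sides is absolutely continuous with derivative zero almost everywhere,
hence constant, and it vanishes at `a`. -/
theorem eqOn_primitive (hab : a < b) (hp : 1 ≤ p) {k : ℕ} {y : ℝ → ℂ}
    (hy : MemSobolev a b p (k + 1) y) :
    EqOn y (fun t => y a + ∫ s in a..t, derivWithin y (Icc a b) s) (Icc a b) := by
  have hy1 : MemSobolev a b p 1 y := by
    rw [add_comm] at hy
    exact hy.mono_add hab k
  have hi : IntegrableOn (derivWithin y (Icc a b)) (Icc a b) :=
    memLp_integrableOn hp (memSobolev_one.1 hy1).2.2
  have hg : AbsolutelyContinuousOnInterval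
      (y - fun t => y a + ∫ s in a..t, derivWithin y (Icc a b) s) a b :=
    (memSobolev_one.1 hy1).2.1.sub (ac_primitive hab hi _)
  have hi' : IntervalIntegrable (derivWithin y (Icc a b)) volume a b :=
    intervalIntegrable_of_mem hi (left_mem_Icc.2 hab.le) (right_mem_Icc.2 hab.le)
  have h0 : ∀ᵐ t, t ∈ uIcc a b →
      HasDerivAt (y - fun t => y a + ∫ s in a..t, derivWithin y (Icc a b) s) 0 t := by
    -- At the end points `derivWithin` is one-sided; discarding them allows it to be replaced by
    -- `deriv`.
    have hna : ∀ᵐ x : ℝ, x ≠ a := by simp [ae_iff, measure_singleton]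
    have hnb : ∀ᵐ x : ℝ, x ≠ b := by simp [ae_iff, measure_singleton]
    filter_upwards [hi'.ae_hasDerivAt_integral,
      (memSobolev_one.1 hy1).2.1.boundedVariationOn.ae_differentiableAt_of_mem_uIcc, hna, hnb]
      with t h1 h2 ha hb ht
    have h3 := (h2 ht).hasDerivAt
    have h4 := (h1 ht a left_mem_uIcc).const_add (y a)
    rw [uIcc_of_le hab.le] at ht
    rw [derivWithin_of_mem_nhds (Icc_mem_nhds (lt_of_le_of_ne ht.1 ha.symm)
      (lt_of_le_of_ne ht.2 hb))] at h4
    simpa using h3.sub h4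
  obtain ⟨C, hC⟩ := hg.const_of_ae_hasDerivAt_zero h0
  rw [uIcc_of_le hab.le] at hC
  intro t ht
  have h1 := hC t ht
  have h2 := hC a (left_mem_Icc.2 hab.le)
  simp only [Pi.sub_apply, intervalIntegral.integral_same, add_zero, sub_self] at h1 h2
  rw [← h2] at h1
  exact sub_eq_zero.1 h1

end calculus

/-! ### Estimates for the Sobolev norm. -/

section norms

variable {a b : ℝ} {p : ℝ≥0∞}

/-- Hölder's inequality on a set of finite measure. For p = ∞ the term `1 / p.toReal` is 0, as it
should be. -/
theorem exists_integral_norm_le (a b : ℝ) (hp : 1 ≤ p) : ∃ C, 0 ≤ C ∧ ∀ f : ℝ → ℂ,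
    MemLp f p (volume.restrict (Icc a b)) →
      ∫ t in Icc a b, ‖f t‖ ≤ C * (eLpNorm f p (volume.restrict (Icc a b))).toReal := by
  refine ⟨((volume.restrict (Icc a b)) univ ^ (1 / (1 : ℝ≥0∞).toReal - 1 / p.toReal)).toReal,
    ENNReal.toReal_nonneg, fun f hf => ?_⟩
  have h := eLpNorm_le_eLpNorm_mul_rpow_measure_univ hp hf.1
  have hfin : (volume.restrict (Icc a b)) univ ^ (1 / (1 : ℝ≥0∞).toReal - 1 / p.toReal) ≠ ⊤ := by
    refine ENNReal.rpow_ne_top_of_nonneg ?_ (by simp)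
    rcases eq_or_ne p ⊤ with rfl | h'
    · simp
    · have : 1 ≤ p.toReal := by
        simpa using ENNReal.toReal_mono h' hp
      simp only [ENNReal.toReal_one, div_one, one_div, sub_nonneg]
      exact inv_le_one_of_one_le₀ this
  rw [integral_norm_eq_lintegral_enorm hf.1, ← eLpNorm_one_eq_lintegral_enorm, ← ENNReal.toReal_mul,
    mul_comm]
  exact ENNReal.toReal_mono (ENNReal.mul_ne_top hf.2.ne hfin) h

theorem exists_eLpNorm_le_of_bound (a b : ℝ) (p : ℝ≥0∞) : ∃ C, 0 ≤ C ∧ ∀ (f : ℝ → ℂ) (K : ℝ),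
    0 ≤ K → (∀ t ∈ Icc a b, ‖f t‖ ≤ K) →
      (eLpNorm f p (volume.restrict (Icc a b))).toReal ≤ C * K := by
  refine ⟨((volume.restrict (Icc a b)) univ ^ p.toReal⁻¹).toReal,
    ENNReal.toReal_nonneg, fun f K hK hf => ?_⟩
  have h := eLpNorm_le_of_ae_bound (p := p) (μ := volume.restrict (Icc a b)) (f := f) (C := K) (by
    rw [ae_restrict_iff' measurableSet_Icc]
    exact ae_of_all _ hf)
  have hfin : (volume.restrict (Icc a b)) univ ^ p.toReal⁻¹ ≠ ⊤ :=
    ENNReal.rpow_ne_top_of_nonneg (by positivity) (by simp)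
  refine (ENNReal.toReal_mono (ENNReal.mul_ne_top hfin ENNReal.ofReal_ne_top) h).trans ?_
  rw [ENNReal.toReal_mul, ENNReal.toReal_ofReal hK]

theorem sobolevNorm_zero_eq (y : ℝ → ℂ) :
    sobolevNorm a b p 0 y = (eLpNorm y p (volume.restrict (Icc a b))).toReal := by
  simp [sobolevNorm]

theorem sobolevNorm_succ (k : ℕ) (y : ℝ → ℂ) :
    sobolevNorm a b p (k + 1) y = (eLpNorm y p (volume.restrict (Icc a b))).toReal +
      sobolevNorm a b p k (derivWithin y (Icc a b)) := by
  rw [sobolevNorm, Finset.sum_range_succ', add_comm]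
  simp [sobolevNorm, iteratedDerivWithin_succ']

theorem eLpNorm_le_sobolevNorm (k : ℕ) (y : ℝ → ℂ) :
    (eLpNorm y p (volume.restrict (Icc a b))).toReal ≤ sobolevNorm a b p k y := by
  cases k with
  | zero => exact (sobolevNorm_zero_eq y).ge
  | succ k =>
    rw [sobolevNorm_succ]
    exact le_add_of_nonneg_right (sobolevNorm_nonneg _ _)

theorem sobolevNorm_mono {k l : ℕ} (h : k ≤ l) (y : ℝ → ℂ) :
    sobolevNorm a b p k y ≤ sobolevNorm a b p l y :=
  Finset.sum_le_sum_of_subset_of_nonneg (Finset.range_mono (by omega))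
    fun _ _ _ => ENNReal.toReal_nonneg

theorem sobolevNorm_iteratedDerivWithin_le (k j : ℕ) (y : ℝ → ℂ) :
    sobolevNorm a b p k (iteratedDerivWithin j y (Icc a b)) ≤ sobolevNorm a b p (k + j) y := by
  induction j generalizing y with
  | zero => simp
  | succ j ih =>
    rw [iteratedDerivWithin_succ', ← add_assoc, sobolevNorm_succ]
    exact (ih _).trans (le_add_of_nonneg_left ENNReal.toReal_nonneg)

/-- The embedding of W_p^1 into C[a,b]: ‖y(t)‖ ≤ ‖y(s)‖ + ∫‖y'‖ for all s, averaged over s in [a,b].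
-/
theorem exists_sup_le_sobolevNorm (hab : a < b) (hp : 1 ≤ p) : ∃ C, 0 ≤ C ∧ ∀ (k : ℕ) (y : ℝ → ℂ),
    MemSobolev a b p (k + 1) y → ∀ t ∈ Icc a b, ‖y t‖ ≤ C * sobolevNorm a b p (k + 1) y := by
  obtain ⟨C, hC, h⟩ := exists_integral_norm_le a b hp
  have hd : 0 < b - a := sub_pos.2 hab
  refine ⟨(b - a)⁻¹ * C + C, by positivity, fun k y hy t ht => ?_⟩
  have hm := hy.derivWithin hab
  have hi := hm.toIntegrableOn hab hp
  have hyi := hy.toIntegrableOn hab hp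
  have ha : a ∈ Icc a b := left_mem_Icc.2 hab.le
  set J := ∫ s in Icc a b, ‖derivWithin y (Icc a b) s‖ with hJ
  have hJ' : J ≤ C * sobolevNorm a b p (k + 1) y := by
    refine (h _ (hm.toMemLp hab)).trans (mul_le_mul_of_nonneg_left ?_ hC)
    rw [sobolevNorm_succ]
    exact (eLpNorm_le_sobolevNorm k _).trans (le_add_of_nonneg_left ENNReal.toReal_nonneg)
  have key : ∀ s ∈ Icc a b, ‖y t‖ ≤ ‖y s‖ + J := by
    intro s hs
    have e : y t - y s = ∫ x in s..t, derivWithin y (Icc a b) x := by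
      rw [eqOn_primitive hab hp hy ht, eqOn_primitive hab hp hy hs]
      simp only [add_sub_add_left_eq_sub]
      exact intervalIntegral.integral_interval_sub_left (intervalIntegrable_of_mem hi ha ht)
        (intervalIntegrable_of_mem hi ha hs)
    have h1 : ‖y t - y s‖ ≤ J := by
      rw [e]
      refine intervalIntegral.norm_integral_le_integral_norm_uIoc.trans ?_
      exact setIntegral_mono_set hi.norm (ae_of_all _ fun _ => norm_nonneg _)
        (uIoc_subset_uIcc.trans (uIcc_subset_Icc hs ht)).eventuallyLE
    linarith [norm_le_insert' (y t) (y s)]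
  have h2 : (b - a) * ‖y t‖ ≤ (∫ s in Icc a b, ‖y s‖) + (b - a) * J := by
    have h3 : ∫ _ in Icc a b, ‖y t‖ ≤ ∫ s in Icc a b, (‖y s‖ + J) :=
      setIntegral_mono_on (by simp) (hyi.norm.add (by simp)) measurableSet_Icc key
    rw [integral_add hyi.norm (by simp)] at h3
    simpa [hab.le] using h3
  have h4 : ∫ s in Icc a b, ‖y s‖ ≤ C * sobolevNorm a b p (k + 1) y :=
    (h _ (hy.toMemLp hab)).trans (mul_le_mul_of_nonneg_left (eLpNorm_le_sobolevNorm _ _) hC)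
  have h5 : ‖y t‖ ≤ (b - a)⁻¹ * (∫ s in Icc a b, ‖y s‖) + J := by
    rw [← mul_le_mul_iff_right₀ hd]
    refine h2.trans (le_of_eq ?_)
    field_simp
  calc ‖y t‖ ≤ _ := h5
    _ ≤ (b - a)⁻¹ * (C * sobolevNorm a b p (k + 1) y) + C * sobolevNorm a b p (k + 1) y := by
      gcongr
    _ = _ := by ring

theorem MemSobolev.eqOn_of_ae_eq (hab : a < b) {k : ℕ} {y z : ℝ → ℂ}
    (hy : MemSobolev a b p (k + 1) y) (hz : MemSobolev a b p (k + 1) z)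
    (h : y =ᵐ[volume.restrict (Icc a b)] z) : EqOn y z (Icc a b) :=
  Measure.eqOn_Icc_of_ae_eq volume hab.ne h hy.toContinuousOn hz.toContinuousOn

theorem sobolevNorm_congr {k : ℕ} {y z : ℝ → ℂ} (h : EqOn y z (Icc a b)) :
    sobolevNorm a b p k y = sobolevNorm a b p k z := by
  refine Finset.sum_congr rfl fun s _ => ?_
  rw [eLpNorm_congr_ae]
  filter_upwards [ae_restrict_mem measurableSet_Icc] with t ht
  exact iteratedDerivWithin_congr h ht

theorem sobolevNorm_congr_ae (hab : a < b) {k : ℕ} {y z : ℝ → ℂ} (hy : MemSobolev a b p k y)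
    (hz : MemSobolev a b p k z) (h : y =ᵐ[volume.restrict (Icc a b)] z) :
    sobolevNorm a b p k y = sobolevNorm a b p k z := by
  cases k with
  | zero => rw [sobolevNorm_zero_eq, sobolevNorm_zero_eq, eLpNorm_congr_ae h]
  | succ k => exact sobolevNorm_congr (hy.eqOn_of_ae_eq hab hz h)

theorem sobolevNorm_eq_zero_iff (hab : a < b) (hp : 1 ≤ p) {k : ℕ} {y : ℝ → ℂ}
    (hy : MemSobolev a b p k y) :
    sobolevNorm a b p k y = 0 ↔ y =ᵐ[volume.restrict (Icc a b)] 0 := by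
  constructor
  · intro h
    have h1 := eLpNorm_le_sobolevNorm (a := a) (b := b) (p := p) k y
    have hm := hy.toMemLp hab
    have h2 : (eLpNorm y p (volume.restrict (Icc a b))).toReal = 0 :=
      le_antisymm (h1.trans h.le) ENNReal.toReal_nonneg
    rw [ENNReal.toReal_eq_zero_iff, or_iff_left hm.2.ne,
      eLpNorm_eq_zero_iff hm.1 (zero_lt_one.trans_le hp).ne'] at h2
    exact h2
  · intro h
    rw [sobolevNorm_congr_ae hab hy (memSobolev_zero hab k) h]
    simpa using sobolevNorm_smul (a := a) (b := b) (p := p) k 0 0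

end norms

/-! ### Multiplication in Sobolev spaces. -/

section product

variable {a b : ℝ} {p : ℝ≥0∞}

theorem MemSobolev.sub (hab : a < b) {k : ℕ} {y z : ℝ → ℂ}
    (hy : MemSobolev a b p k y) (hz : MemSobolev a b p k z) : MemSobolev a b p k (y - z) := by
  have := hy.add hab (hz.smul (-1))
  simpa [sub_eq_add_neg] using this

theorem derivWithin_sub_ae (hab : a < b) {k : ℕ} {y z : ℝ → ℂ}
    (hy : MemSobolev a b p (k + 1) y) (hz : MemSobolev a b p (k + 1) z) :
    derivWithin (y - z) (Icc a b) =ᵐ[volume.restrict (Icc a b)]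
      derivWithin y (Icc a b) - derivWithin z (Icc a b) := by
  filter_upwards [hy.ae_differentiableWithinAt hab, hz.ae_differentiableWithinAt hab] with t h1 h2
  exact derivWithin_sub h1 h2

theorem derivWithin_mul_ae (hab : a < b) {k : ℕ} {y z : ℝ → ℂ}
    (hy : MemSobolev a b p (k + 1) y) (hz : MemSobolev a b p (k + 1) z) :
    derivWithin (y * z) (Icc a b) =ᵐ[volume.restrict (Icc a b)]
      derivWithin y (Icc a b) * z + derivWithin z (Icc a b) * y := by
  filter_upwards [hy.ae_differentiableWithinAt hab, hz.ae_differentiableWithinAt hab] with t h1 h2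
  simp only [Pi.add_apply, Pi.mul_apply]
  rw [derivWithin_mul h1 h2]
  ring

theorem MemSobolev.mul_self (hab : a < b) {k : ℕ} {f g : ℝ → ℂ}
    (hf : MemSobolev a b p (k + 1) f) (hg : MemSobolev a b p (k + 1) g) :
    MemSobolev a b p (k + 1) (f * g) := by
  have hs := ((hf.derivWithin hab).mul hab hg).add hab ((hg.derivWithin hab).mul hab hf)
  cases k with
  | zero =>
    exact memSobolev_one_of_ac hab ((memSobolev_one.1 hf).2.1.smul (memSobolev_one.1 hg).2.1) hs
      (derivWithin_mul_ae hab hf hg)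
  | succ k =>
    have df := ((memSobolev_succ_succ hab).1 hf).1
    have dg := ((memSobolev_succ_succ hab).1 hg).1
    refine (memSobolev_succ_succ hab).2 ⟨df.mul dg, hs.congr hab fun t ht => ?_⟩
    simp only [Pi.add_apply, Pi.mul_apply]
    rw [derivWithin_mul (df t ht) (dg t ht)]
    ring

theorem exists_eLpNorm_mul_le (hab : a < b) (hp : 1 ≤ p) : ∃ C, 0 ≤ C ∧ ∀ (k : ℕ) (f g : ℝ → ℂ),
    MemLp f p (volume.restrict (Icc a b)) → MemSobolev a b p (k + 1) g →
      (eLpNorm (f * g) p (volume.restrict (Icc a b))).toReal ≤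
        C * (eLpNorm f p (volume.restrict (Icc a b))).toReal * sobolevNorm a b p (k + 1) g := by
  obtain ⟨C, hC, h⟩ := exists_sup_le_sobolevNorm hab hp
  refine ⟨C, hC, fun k f g hf hg => ?_⟩
  have h1 : ∀ᵐ t ∂(volume.restrict (Icc a b)),
      ‖(f * g) t‖ ≤ (C * sobolevNorm a b p (k + 1) g) * ‖f t‖ := by
    filter_upwards [ae_restrict_mem measurableSet_Icc] with t ht
    rw [Pi.mul_apply, norm_mul, mul_comm]
    exact mul_le_mul_of_nonneg_right (h k g hg t ht) (norm_nonneg _)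
  have h2 := eLpNorm_le_mul_eLpNorm_of_ae_le_mul h1 p
  refine (ENNReal.toReal_mono (ENNReal.mul_ne_top ENNReal.ofReal_ne_top hf.2.ne) h2).trans ?_
  rw [ENNReal.toReal_mul, ENNReal.toReal_ofReal (mul_nonneg hC (sobolevNorm_nonneg _ _))]
  exact le_of_eq (by ring)

/-- Induction by (fg)' = f'g + g'f. The second factor has one derivative more because L_p is not an
algebra: at n = 0 it must be bounded. Both products on the right keep this asymmetry, so the
induction hypothesis applies to each. -/
theorem exists_sobolevNorm_mul_le (hab : a < b) (hp : 1 ≤ p) (n : ℕ) : ∃ C, 0 ≤ C ∧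
    ∀ f g : ℝ → ℂ, MemSobolev a b p n f → MemSobolev a b p (n + 1) g →
      sobolevNorm a b p n (f * g) ≤ C * sobolevNorm a b p n f * sobolevNorm a b p (n + 1) g := by
  obtain ⟨C₀, hC₀, h₀⟩ := exists_eLpNorm_mul_le hab hp
  induction n with
  | zero =>
    refine ⟨C₀, hC₀, fun f g hf hg => ?_⟩
    rw [sobolevNorm_zero_eq, sobolevNorm_zero_eq]
    exact h₀ 0 f g hf hg
  | succ n ih =>
    obtain ⟨C, hC, h⟩ := ih
    refine ⟨C₀ + C + C, by positivity, fun f g hf hg => ?_⟩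
    have hg' := hg.mono hab
    have df := hf.derivWithin hab
    have dg := hg.derivWithin hab
    have e1 : sobolevNorm a b p n (derivWithin (f * g) (Icc a b)) =
        sobolevNorm a b p n (derivWithin f (Icc a b) * g + derivWithin g (Icc a b) * f) :=
      sobolevNorm_congr_ae hab ((hf.mul_self hab hg').derivWithin hab)
        ((df.mul hab hg').add hab ((dg.mono hab).mul hab hf)) (derivWithin_mul_ae hab hf hg')
    have e2 := sobolevNorm_add_le hab hp (df.mul hab hg') ((dg.mono hab).mul hab hf)
    have e3 := h _ _ df hg'
    have e4 := h _ _ (hf.mono hab) dg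
    rw [mul_comm f] at e4
    have e5 := h₀ _ _ _ (hf.toMemLp hab) hg
    have n1 := eLpNorm_le_sobolevNorm (a := a) (b := b) (p := p) (n + 1) f
    have n2 := sobolevNorm_mono (a := a) (b := b) (p := p) (Nat.le_succ n) f
    have n3 := sobolevNorm_mono (a := a) (b := b) (p := p) (Nat.le_succ (n + 1)) g
    have n4 : sobolevNorm a b p n (derivWithin f (Icc a b)) ≤ sobolevNorm a b p (n + 1) f := by
      rw [sobolevNorm_succ]
      exact le_add_of_nonneg_left ENNReal.toReal_nonneg
    have n5 : sobolevNorm a b p (n + 1) (derivWithin g (Icc a b)) ≤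
        sobolevNorm a b p (n + 1 + 1) g := by
      rw [sobolevNorm_succ (n + 1)]
      exact le_add_of_nonneg_left ENNReal.toReal_nonneg
    have pos : ∀ (k : ℕ) (y : ℝ → ℂ), 0 ≤ sobolevNorm a b p k y := sobolevNorm_nonneg
    have m1 : C₀ * (eLpNorm f p (volume.restrict (Icc a b))).toReal *
        sobolevNorm a b p (n + 1 + 1) g ≤
        C₀ * sobolevNorm a b p (n + 1) f * sobolevNorm a b p (n + 1 + 1) g := by
      gcongr
      exact pos _ _
    have m2 : C * sobolevNorm a b p n (derivWithin f (Icc a b)) * sobolevNorm a b p (n + 1) g ≤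
        C * sobolevNorm a b p (n + 1) f * sobolevNorm a b p (n + 1 + 1) g := by
      gcongr
      · exact pos _ _
      · exact mul_nonneg hC (pos _ _)
    have m3 : C * sobolevNorm a b p n f * sobolevNorm a b p (n + 1) (derivWithin g (Icc a b)) ≤
        C * sobolevNorm a b p (n + 1) f * sobolevNorm a b p (n + 1 + 1) g := by
      gcongr
      · exact pos _ _
      · exact mul_nonneg hC (pos _ _)
    rw [sobolevNorm_succ n (f * g), e1]
    linarith

end product

/-! ### Completeness of the scalar spaces. -/

section completeness

variable {a b : ℝ} {p : ℝ≥0∞}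

/-- Since y is y(a) plus the primitive of y', convergence in W_p^{k+1} reduces to convergence of
y(a) and of y' in W_p^k. -/
theorem exists_sobolevNorm_succ_le (hab : a < b) (hp : 1 ≤ p) : ∃ C, 0 ≤ C ∧
    ∀ (k : ℕ) (y : ℝ → ℂ), MemSobolev a b p (k + 1) y →
      sobolevNorm a b p (k + 1) y ≤
        C * (‖y a‖ + sobolevNorm a b p k (derivWithin y (Icc a b))) := by
  obtain ⟨C, hC, h⟩ := exists_integral_norm_le a b hp
  obtain ⟨D, hD, h'⟩ := exists_eLpNorm_le_of_bound a b p
  refine ⟨D + D * C + 1, by positivity, fun k y hy => ?_⟩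
  have hm := hy.derivWithin hab
  have hi := hm.toIntegrableOn hab hp
  set S := sobolevNorm a b p k (derivWithin y (Icc a b)) with hS
  have hS0 : 0 ≤ S := sobolevNorm_nonneg _ _
  have hJ : ∫ s in Icc a b, ‖derivWithin y (Icc a b) s‖ ≤ C * S :=
    (h _ (hm.toMemLp hab)).trans (mul_le_mul_of_nonneg_left (eLpNorm_le_sobolevNorm k _) hC)
  have key : ∀ t ∈ Icc a b, ‖y t‖ ≤ ‖y a‖ + C * S := by
    intro t ht
    rw [eqOn_primitive hab hp hy ht]
    refine (norm_add_le _ _).trans ?_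
    gcongr
    refine (intervalIntegral.norm_integral_le_integral_norm_uIoc.trans ?_).trans hJ
    exact setIntegral_mono_set hi.norm (ae_of_all _ fun _ => norm_nonneg _)
      (uIoc_subset_uIcc.trans (uIcc_subset_Icc (left_mem_Icc.2 hab.le) ht)).eventuallyLE
  have h1 := h' y _ (by positivity) key
  rw [sobolevNorm_succ]
  have h2 : 0 ≤ D * C * ‖y a‖ := by positivity
  nlinarith [norm_nonneg (y a), mul_nonneg hD hS0]

/-- Induction on k from the completeness of L_p. If v is the limit of the derivatives and c that of
the values at `a`, which converge by the sup bound, the limit is c + ∫v. -/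
theorem exists_sobolev_limit (hab : a < b) (hp : 1 ≤ p) (k : ℕ) (y : ℕ → ℝ → ℂ)
    (hy : ∀ i, MemSobolev a b p k (y i))
    (hc : Tendsto (fun i : ℕ × ℕ => sobolevNorm a b p k (y i.1 - y i.2)) atTop (𝓝 0)) :
    ∃ z, MemSobolev a b p k z ∧ Tendsto (fun i => sobolevNorm a b p k (y i - z)) atTop (𝓝 0) := by
  induction k generalizing y with
  | zero =>
    have : Fact (1 ≤ p) := ⟨hp⟩
    have hd : ∀ (f g : ℝ → ℂ) (hf : MemLp f p (volume.restrict (Icc a b)))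
        (hg : MemLp g p (volume.restrict (Icc a b))),
        dist (hf.toLp f) (hg.toLp g) = sobolevNorm a b p 0 (f - g) := by
      intro f g hf hg
      rw [sobolevNorm_zero_eq, dist_edist, Lp.edist_toLp_toLp]
    have hcau : CauchySeq fun i => (hy i).toLp (y i) := by
      rw [cauchySeq_iff_tendsto_dist_atTop_0]
      exact hc.congr fun i => (hd _ _ (hy _) (hy _)).symm
    obtain ⟨F, hF⟩ := cauchySeq_tendsto_of_complete hcau
    refine ⟨F, Lp.memLp F, ?_⟩
    rw [tendsto_iff_dist_tendsto_zero] at hF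
    refine hF.congr fun i => ?_
    rw [← hd _ _ (hy i) (Lp.memLp F), Lp.toLp_coeFn]
  | succ k ih =>
    have pos : ∀ (l : ℕ) (u : ℝ → ℂ), 0 ≤ sobolevNorm a b p l u := sobolevNorm_nonneg
    have hle : ∀ u z : ℝ → ℂ, MemSobolev a b p (k + 1) u → MemSobolev a b p (k + 1) z →
        sobolevNorm a b p k (derivWithin (u - z) (Icc a b)) =
          sobolevNorm a b p k (derivWithin u (Icc a b) - derivWithin z (Icc a b)) :=
      fun u z hu hz => sobolevNorm_congr_ae hab ((hu.sub hab hz).derivWithin hab)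
        ((hu.derivWithin hab).sub hab (hz.derivWithin hab)) (derivWithin_sub_ae hab hu hz)
    obtain ⟨v, hv, hlim⟩ := ih (fun i => derivWithin (y i) (Icc a b))
      (fun i => (hy i).derivWithin hab) (by
        refine squeeze_zero (fun _ => pos _ _) (fun i => ?_) hc
        rw [← hle _ _ (hy _) (hy _), sobolevNorm_succ]
        exact le_add_of_nonneg_left ENNReal.toReal_nonneg)
    obtain ⟨C, hC, h⟩ := exists_sup_le_sobolevNorm hab hp
    have hcau : CauchySeq fun i => y i a := by
      rw [cauchySeq_iff_tendsto_dist_atTop_0]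
      refine squeeze_zero (fun _ => dist_nonneg) (fun i => ?_) (by simpa using hc.const_mul C)
      rw [dist_eq_norm]
      exact h k _ ((hy _).sub hab (hy _)) a (left_mem_Icc.2 hab.le)
    obtain ⟨c, hcl⟩ := cauchySeq_tendsto_of_complete hcau
    have hz := memSobolev_primitive hab hp hv c
    refine ⟨_, hz, ?_⟩
    obtain ⟨D, hD, h'⟩ := exists_sobolevNorm_succ_le hab hp
    rw [tendsto_iff_norm_sub_tendsto_zero] at hcl
    have he : ∀ i, sobolevNorm a b p k
        (derivWithin (y i - fun t => c + ∫ s in a..t, v s) (Icc a b)) =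
          sobolevNorm a b p k (derivWithin (y i) (Icc a b) - v) := by
      intro i
      rw [hle _ _ (hy i) hz]
      refine sobolevNorm_congr_ae hab (((hy i).derivWithin hab).sub hab (hz.derivWithin hab))
        (((hy i).derivWithin hab).sub hab hv) ?_
      filter_upwards [derivWithin_primitive_ae hab (hv.toIntegrableOn hab hp) c] with t ht
      simp only [Pi.sub_apply, ht]
    refine squeeze_zero (fun _ => pos _ _) (fun i => ?_)
      (by simpa using (hcl.add hlim).const_mul D)
    refine (h' k _ ((hy i).sub hab hz)).trans (le_of_eq ?_)
    rw [he i]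
    simp

end completeness

/-! ### Finite sums, and the vector-valued space as a complete seminormed space. -/

theorem MemSobolev.sum {a b : ℝ} {p : ℝ≥0∞} (hab : a < b) {k : ℕ} {κ : Type*} (s : Finset κ)
    {F : κ → ℝ → ℂ} (hF : ∀ x ∈ s, MemSobolev a b p k (F x)) :
    MemSobolev a b p k (∑ x ∈ s, F x) := by
  classical
  induction s using Finset.induction_on with
  | empty => exact memSobolev_zero hab k
  | insert x s hx ih =>
    rw [Finset.sum_insert hx]
    exact (hF x (by simp)).add hab (ih fun z hz => hF z (by simp [hz]))

theorem sobolevNorm_sum_le {a b : ℝ} {p : ℝ≥0∞} (hab : a < b) (hp : 1 ≤ p) {k : ℕ} {κ : Type*}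
    (s : Finset κ) {F : κ → ℝ → ℂ} (hF : ∀ x ∈ s, MemSobolev a b p k (F x)) :
    sobolevNorm a b p k (∑ x ∈ s, F x) ≤ ∑ x ∈ s, sobolevNorm a b p k (F x) := by
  classical
  induction s using Finset.induction_on with
  | empty => simpa using (sobolevNorm_smul (a := a) (b := b) (p := p) k 0 0).le
  | insert x s hx ih =>
    rw [Finset.sum_insert hx, Finset.sum_insert hx]
    have hs : ∀ z ∈ s, MemSobolev a b p k (F z) := fun z hz => hF z (by simp [hz])
    exact (sobolevNorm_add_le hab hp (hF x (by simp)) (MemSobolev.sum hab s hs)).trans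
      (add_le_add le_rfl (ih hs))

namespace SobolevSpace

variable {a b : ℝ} {hab : a < b} {k : ℕ} {p : ℝ≥0∞} {ι : Type*}

theorem norm_def [Fintype ι] (y : SobolevSpace hab k p ι) :
    ‖y‖ = ∑ i, sobolevNorm a b p k (fun t => y t i) := rfl

theorem sobolevNorm_le_norm [Fintype ι] (y : SobolevSpace hab k p ι) (i : ι) :
    sobolevNorm a b p k (fun t => y t i) ≤ ‖y‖ :=
  Finset.single_le_sum (f := fun i => sobolevNorm a b p k (fun t => y t i))
    (fun _ _ => sobolevNorm_nonneg _ _) (Finset.mem_univ i)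

variable [Fact (1 ≤ p)]

theorem norm_sub_eq_zero_iff [Fintype ι] (y z : SobolevSpace hab k p ι) :
    ‖y - z‖ = 0 ↔ ∀ i, (fun t => y t i) =ᵐ[volume.restrict (Icc a b)] fun t => z t i := by
  rw [norm_def, Finset.sum_eq_zero_iff_of_nonneg fun _ _ => sobolevNorm_nonneg _ _]
  refine ⟨fun h i => ?_, fun h i _ => ?_⟩
  · have := (sobolevNorm_eq_zero_iff hab Fact.out ((y - z).2 i)).1 (h i (Finset.mem_univ i))
    filter_upwards [this] with t ht
    exact sub_eq_zero.1 ht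
  · refine (sobolevNorm_eq_zero_iff hab Fact.out ((y - z).2 i)).2 ?_
    filter_upwards [h i] with t ht
    exact sub_eq_zero.2 ht

theorem norm_sub_eq_zero_iff_eqOn [Fintype ι] (hk : 1 ≤ k) (y z : SobolevSpace hab k p ι) :
    ‖y - z‖ = 0 ↔ ∀ t ∈ Icc a b, y t = z t := by
  obtain ⟨k, rfl⟩ := Nat.exists_eq_add_of_le' hk
  rw [norm_sub_eq_zero_iff]
  refine ⟨fun h t ht => funext fun i => (y.2 i).eqOn_of_ae_eq hab (z.2 i) (h i) ht,
    fun h i => ?_⟩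
  filter_upwards [ae_restrict_mem measurableSet_Icc] with t ht
  exact congrFun (h t ht) i

instance [Fintype ι] : CompleteSpace (SobolevSpace hab k p ι) := by
  refine Metric.complete_of_cauchySeq_tendsto fun u hu => ?_
  rw [cauchySeq_iff_tendsto_dist_atTop_0] at hu
  have hlim : ∀ i, ∃ z, MemSobolev a b p k z ∧
      Tendsto (fun n => sobolevNorm a b p k ((fun t => u n t i) - z)) atTop (𝓝 0) := by
    intro i
    refine exists_sobolev_limit hab Fact.out k (fun n t => u n t i) (fun n => (u n).2 i) ?_
    refine squeeze_zero (fun _ => sobolevNorm_nonneg _ _) (fun n => ?_) hu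
    rw [dist_eq_norm]
    exact sobolevNorm_le_norm (u n.1 - u n.2) i
  choose z hz hzl using hlim
  let w : SobolevSpace hab k p ι := ⟨fun t i => z i t, hz⟩
  refine ⟨w, tendsto_iff_norm_sub_tendsto_zero.2 ?_⟩
  have := tendsto_finsetSum (Finset.univ : Finset ι) fun i _ => hzl i
  simpa using! this

end SobolevSpace

/-! ### The differential expression as a bounded operator. -/

section operator

variable {a b : ℝ} {hab : a < b} {n m r : ℕ} {p : ℝ≥0∞}

/-- Coefficients multiply only derivatives of order below r, which leaves the spare derivative that
the product estimate needs. -/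
theorem memSobolev_iteratedDerivWithin_of_lt (y : SobolevSpace hab (n + r) p (Fin m)) (j : Fin r)
    (l : Fin m) : MemSobolev a b p (n + 1)
      (iteratedDerivWithin j (fun τ => y τ l) (Icc a b)) := by
  refine MemSobolev.mono_add hab (r - 1 - j) (MemSobolev.iteratedDerivWithin hab j ?_)
  have := y.2 l
  have hj := j.2
  rwa [show n + 1 + (r - 1 - (j : ℕ)) + j = n + r by omega]

theorem diffOp_apply (A : Fin r → SobolevSpace hab n p (Fin m × Fin m))
    (y : SobolevSpace hab (n + r) p (Fin m)) (t : ℝ) (i : Fin m) :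
    diffOp A y t i = iteratedDerivWithin r (fun τ => y τ i) (Icc a b) t +
      ∑ j : Fin r, ∑ l : Fin m,
        A j t (i, l) * iteratedDerivWithin j (fun τ => y τ l) (Icc a b) t := rfl

theorem diffOp_smul (A : Fin r → SobolevSpace hab n p (Fin m × Fin m)) (c : ℂ)
    (y : SobolevSpace hab (n + r) p (Fin m)) : diffOp A (c • y) = c • diffOp A y := by
  refine Subtype.ext (funext fun t => funext fun i => ?_)
  change diffOp A (c • y) t i = c * diffOp A y t i
  have h : ∀ (s : ℕ) (l : Fin m), iteratedDerivWithin s (fun τ => (c • y) τ l) (Icc a b) t =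
      c * iteratedDerivWithin s (fun τ => y τ l) (Icc a b) t :=
    fun s l => congrFun (iteratedDerivWithin_smul_all s c fun τ => y τ l) t
  simp only [diffOp_apply, h, mul_add, Finset.mul_sum]
  congr 1
  exact Finset.sum_congr rfl fun j _ => Finset.sum_congr rfl fun l _ => by ring

theorem norm_diffOp_zero_le (y : SobolevSpace hab (n + r) p (Fin m)) :
    ‖diffOp (0 : Fin r → SobolevSpace hab n p (Fin m × Fin m)) y‖ ≤ ‖y‖ := by
  rw [SobolevSpace.norm_def, SobolevSpace.norm_def]
  refine Finset.sum_le_sum fun i _ => ?_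
  have h : (fun t => diffOp (0 : Fin r → SobolevSpace hab n p (Fin m × Fin m)) y t i) =
      iteratedDerivWithin r (fun τ => y τ i) (Icc a b) := by
    funext t
    have h0 : ∀ q : Fin m × Fin m, (0 : SobolevSpace hab n p (Fin m × Fin m)) t q = 0 :=
      fun _ => rfl
    simp [diffOp_apply, h0]
  rw [h]
  exact sobolevNorm_iteratedDerivWithin_le n r _

variable [Fact (1 ≤ p)]

/-- The end points form a null set, and for n ≥ 1 continuity upgrades equality almost everywhere to
equality everywhere; so one seminorm condition covers both readings of the equation. -/
theorem isSolution_iff (A : Fin r → SobolevSpace hab n p (Fin m × Fin m))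
    (B : SobolevSpace hab (n + r) p (Fin m) →L[ℂ] CVec (r * m))
    (f : SobolevSpace hab n p (Fin m)) (c : CVec (r * m))
    (y : SobolevSpace hab (n + r) p (Fin m)) :
    IsSolution A B f c y ↔ ‖diffOp A y - f‖ = 0 ∧ B y = c := by
  have hae : ‖diffOp A y - f‖ = 0 ↔ ∀ᵐ t, t ∈ Ioo a b → diffOp A y t = f t := by
    rw [SobolevSpace.norm_sub_eq_zero_iff, ← restrict_Ioo_eq_restrict_Icc]
    simp only [Filter.EventuallyEq, ← ae_all_iff, funext_iff]
    rw [ae_restrict_iff' measurableSet_Ioo]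
  unfold IsSolution
  rcases Nat.eq_zero_or_pos n with hn | hn
  · rw [hae]
    exact ⟨fun h => ⟨h.2.1 hn, h.2.2⟩, fun h => ⟨fun h' => absurd hn (by omega), fun _ => h.1, h.2⟩⟩
  · constructor
    · rintro ⟨h1, -, h3⟩
      exact ⟨hae.2 (ae_of_all _ (h1 hn)), h3⟩
    · rintro ⟨h1, h2⟩
      refine ⟨fun _ t ht => ?_, fun h => absurd h (by omega), h2⟩
      exact (SobolevSpace.norm_sub_eq_zero_iff_eqOn hn _ _).1 h1 t (Ioo_subset_Icc_self ht)

/-- For n = 0 the derivative of order r may fail to exist on a null set, where its default value is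
not additive. Additivity thus holds only up to seminorm zero. -/
theorem norm_diffOp_add (A : Fin r → SobolevSpace hab n p (Fin m × Fin m))
    (y z : SobolevSpace hab (n + r) p (Fin m)) :
    ‖diffOp A (y + z) - (diffOp A y + diffOp A z)‖ = 0 := by
  rw [SobolevSpace.norm_sub_eq_zero_iff]
  intro i
  have h1 : ∀ᵐ t ∂(volume.restrict (Icc a b)), ∀ (l : Fin m) (s : Fin (r + 1)),
      iteratedDerivWithin s (fun τ => (y + z) τ l) (Icc a b) t =
        iteratedDerivWithin s (fun τ => y τ l) (Icc a b) t +
          iteratedDerivWithin s (fun τ => z τ l) (Icc a b) t :=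
    ae_all_iff.2 fun l => ae_all_iff.2 fun s =>
      iteratedDerivWithin_add_ae hab (by omega) (y.2 l) (z.2 l)
  filter_upwards [h1] with t ht
  change diffOp A (y + z) t i = diffOp A y t i + diffOp A z t i
  simp only [diffOp_apply]
  have hr := ht i (Fin.last r)
  simp only [Fin.val_last] at hr
  have hj : ∀ (l : Fin m) (j : Fin r), _ := fun l j => ht l j.castSucc
  simp only [Fin.val_castSucc] at hj
  rw [hr]
  simp only [hj, mul_add, Finset.sum_add_distrib]
  ring

/-- The leading terms y^(r) cancel, and the product estimate handles the rest. The bound is linear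
in the coefficient differences, which turns (I) into operator-norm convergence. -/
theorem exists_norm_diffOp_sub_le (hab : a < b) (n m r : ℕ) (p : ℝ≥0∞) [Fact (1 ≤ p)] :
    ∃ C, 0 ≤ C ∧ ∀ (A A' : Fin r → SobolevSpace hab n p (Fin m × Fin m))
      (y : SobolevSpace hab (n + r) p (Fin m)),
      ‖diffOp A y - diffOp A' y‖ ≤ C * (∑ j, ‖A j - A' j‖) * ‖y‖ := by
  obtain ⟨C, hC, h⟩ := exists_sobolevNorm_mul_le hab (Fact.out : 1 ≤ p) n
  refine ⟨C, hC, fun A A' y => ?_⟩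
  have hmem : ∀ (i : Fin m) (j : Fin r) (l : Fin m), MemSobolev a b p n
      ((fun t => (A j - A' j) t (i, l)) * iteratedDerivWithin j (fun τ => y τ l) (Icc a b)) :=
    fun i j l => ((A j - A' j).2 (i, l)).mul hab (memSobolev_iteratedDerivWithin_of_lt y j l)
  have hcomp : ∀ i : Fin m, sobolevNorm a b p n (fun t => (diffOp A y - diffOp A' y) t i) ≤
      ∑ j : Fin r, ∑ l : Fin m,
        C * sobolevNorm a b p n (fun t => (A j - A' j) t (i, l)) * ‖y‖ := by
    intro i
    have e : (fun t => (diffOp A y - diffOp A' y) t i) = ∑ j : Fin r, ∑ l : Fin m,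
        (fun t => (A j - A' j) t (i, l)) * iteratedDerivWithin j (fun τ => y τ l) (Icc a b) := by
      funext t
      change diffOp A y t i - diffOp A' y t i = _
      simp only [diffOp_apply, add_sub_add_left_eq_sub, ← Finset.sum_sub_distrib, ← sub_mul,
        Finset.sum_apply, Pi.mul_apply]
      rfl
    rw [e]
    refine (sobolevNorm_sum_le hab Fact.out _ fun j _ => MemSobolev.sum hab _
      fun l _ => hmem i j l).trans (Finset.sum_le_sum fun j _ => ?_)
    refine (sobolevNorm_sum_le hab Fact.out _ fun l _ => hmem i j l).trans
      (Finset.sum_le_sum fun l _ => ?_)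
    refine (h _ _ ((A j - A' j).2 (i, l)) (memSobolev_iteratedDerivWithin_of_lt y j l)).trans ?_
    refine mul_le_mul_of_nonneg_left ?_ (mul_nonneg hC (sobolevNorm_nonneg _ _))
    refine (sobolevNorm_iteratedDerivWithin_le (n + 1) j _).trans ?_
    exact (sobolevNorm_mono (by omega) _).trans (SobolevSpace.sobolevNorm_le_norm y l)
  rw [SobolevSpace.norm_def (diffOp A y - diffOp A' y)]
  refine (Finset.sum_le_sum fun i _ => hcomp i).trans (le_of_eq ?_)
  rw [Finset.sum_comm, Finset.mul_sum, Finset.sum_mul]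
  refine Finset.sum_congr rfl fun j _ => ?_
  rw [SobolevSpace.norm_def (A j - A' j), Finset.mul_sum, Finset.sum_mul, Fintype.sum_prod_type]

/-- The differential expression as a bounded operator into `(W_p^n)^m` with functions equal almost
everywhere identified. -/
noncomputable def diffOpL (A : Fin r → SobolevSpace hab n p (Fin m × Fin m)) :
    SobolevSpace hab (n + r) p (Fin m) →L[ℂ] SeparationQuotient (SobolevSpace hab n p (Fin m)) :=
  LinearMap.mkContinuousOfExistsBound
    { toFun := fun y => SeparationQuotient.mk (diffOp A y)
      map_add' := fun y z => by
        rw [← SeparationQuotient.mk_add, ← sub_eq_zero, ← norm_eq_zero, ← SeparationQuotient.mk_sub,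
          SeparationQuotient.norm_mk]
        exact norm_diffOp_add A y z
      map_smul' := fun c y => by
        rw [diffOp_smul]
        rfl }
    (by
      obtain ⟨C, hC, h⟩ := exists_norm_diffOp_sub_le hab n m r p
      refine ⟨C * (∑ j, ‖A j - 0‖) + 1, fun y => ?_⟩
      change ‖SeparationQuotient.mk (diffOp A y)‖ ≤ _
      rw [SeparationQuotient.norm_mk]
      -- Boundedness comes from comparison with the zero coefficients, for which the expression is
      -- just y^(r).
      have h1 := h A 0 y
      have h2 := norm_diffOp_zero_le (n := n) y
      have h3 := norm_le_norm_add_norm_sub' (diffOp A y) (diffOp 0 y)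
      simp only [Pi.zero_apply] at h1
      linarith)

theorem diffOpL_apply (A : Fin r → SobolevSpace hab n p (Fin m × Fin m))
    (y : SobolevSpace hab (n + r) p (Fin m)) :
    diffOpL A y = SeparationQuotient.mk (diffOp A y) := rfl

theorem tendsto_diffOpL {M : Type*} [MetricSpace M]
    {A : M → Fin r → SobolevSpace hab n p (Fin m × Fin m)} {μ₀ : M}
    (hA : LimitConditionI A μ₀) :
    Tendsto (fun μ => diffOpL (A μ)) (𝓝 μ₀) (𝓝 (diffOpL (A μ₀))) := by
  obtain ⟨C, hC, h⟩ := exists_norm_diffOp_sub_le hab n m r p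
  rw [tendsto_iff_norm_sub_tendsto_zero]
  have h1 : Tendsto (fun μ => C * ∑ j, ‖A μ j - A μ₀ j‖) (𝓝 μ₀) (𝓝 0) := by
    have := (tendsto_finsetSum Finset.univ fun j _ =>
      tendsto_iff_norm_sub_tendsto_zero.1 (hA j)).const_mul C
    simpa using this
  refine squeeze_zero (fun _ => norm_nonneg _) (fun μ => ?_) h1
  refine ContinuousLinearMap.opNorm_le_bound _ (by positivity) fun y => ?_
  change ‖diffOpL (A μ) y - diffOpL (A μ₀) y‖ ≤ _
  rw [diffOpL_apply, diffOpL_apply, ← SeparationQuotient.mk_sub, SeparationQuotient.norm_mk]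
  exact h _ _ y

end operator

/-! ### Perturbation of a bijective pair under strong convergence of the finite-rank part. -/

section abstract

variable {M : Type*} [MetricSpace M]

/-- Strong convergence gives pointwise boundedness only along sequences, so an unbounded sequence
tending to μ₀ is extracted first; Banach–Steinhaus then contradicts its growth. -/
theorem exists_eventually_norm_le {E G : Type*} [SeminormedAddCommGroup E] [NormedSpace ℂ E]
    [CompleteSpace E] [SeminormedAddCommGroup G] [NormedSpace ℂ G] {B : M → E →L[ℂ] G} {μ₀ : M}
    (hB : ∀ y, Tendsto (fun μ => B μ y) (𝓝 μ₀) (𝓝 (B μ₀ y))) :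
    ∃ K, ∀ᶠ μ in 𝓝 μ₀, ‖B μ‖ ≤ K := by
  by_contra! hcon
  have hk : ∀ k : ℕ, ∃ μ, dist μ μ₀ < 1 / ((k : ℝ) + 1) ∧ (k : ℝ) < ‖B μ‖ := by
    intro k
    obtain ⟨μ, h1, h2⟩ := ((hcon k).and_eventually
      (Metric.ball_mem_nhds μ₀ (Nat.one_div_pos_of_nat (α := ℝ) (n := k)))).exists
    exact ⟨μ, h2, not_le.1 (by simpa using h1)⟩
  choose u hu hun using hk
  have hlim : Tendsto u atTop (𝓝 μ₀) := by
    rw [tendsto_iff_dist_tendsto_zero]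
    exact squeeze_zero (fun _ => dist_nonneg) (fun k => (hu k).le)
      tendsto_one_div_add_atTop_nhds_zero_nat
  obtain ⟨C, hC⟩ := banach_steinhaus (g := fun k => B (u k)) fun y => by
    obtain ⟨C, hC⟩ := ((hB y).comp hlim).norm.bddAbove_range
    exact ⟨C, fun k => hC ⟨k, rfl⟩⟩
  obtain ⟨k, hk⟩ := exists_nat_gt C
  exact absurd (hC k) (not_le.2 (hk.trans (hun k)))

theorem tendsto_of_tendsto_apply {E G : Type*} [NormedAddCommGroup E] [NormedSpace ℂ E]
    [FiniteDimensional ℂ E] [NormedAddCommGroup G] [NormedSpace ℂ G] {S : M → E →L[ℂ] G} {μ₀ : M}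
    (hS : ∀ y, Tendsto (fun μ => S μ y) (𝓝 μ₀) (𝓝 0)) : Tendsto (fun μ => ‖S μ‖) (𝓝 μ₀) (𝓝 0) := by
  obtain ⟨C, hC, h⟩ := (Module.finBasis ℂ E).exists_opNorm_le (F := G)
  have h1 : Tendsto (fun μ => C * ∑ i, ‖S μ (Module.finBasis ℂ E i)‖) (𝓝 μ₀) (𝓝 0) := by
    have := (tendsto_finsetSum Finset.univ fun i _ =>
      (hS (Module.finBasis ℂ E i)).norm).const_mul C
    simpa using this
  refine squeeze_zero (fun _ => norm_nonneg _) (fun μ => ?_) h1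
  exact h (Finset.sum_nonneg fun _ _ => norm_nonneg _) fun i =>
    Finset.single_le_sum (f := fun i => ‖S μ (Module.finBasis ℂ E i)‖)
      (fun _ _ => norm_nonneg _) (Finset.mem_univ i)

/-- `B` is injective on the kernel of `L`, so the images of the `v i` form a basis of `G`. Any
solution of L e = f can then be corrected by a combination of the `v i` to meet B y = g. -/
theorem surjective_prod_of_injective {E F G : Type*} [AddCommGroup E] [Module ℂ E]
    [AddCommGroup F] [Module ℂ F] [AddCommGroup G] [Module ℂ G] [FiniteDimensional ℂ G]
    (L : E →ₗ[ℂ] F) (B : E →ₗ[ℂ] G) (hinj : ∀ y, L y = 0 → B y = 0 → y = 0)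
    (hL : Function.Surjective L) (v : Fin (Module.finrank ℂ G) → E) (hv : LinearIndependent ℂ v)
    (hLv : ∀ i, L (v i) = 0) (f : F) (g : G) : ∃ y, L y = f ∧ B y = g := by
  have hLs : ∀ c : Fin (Module.finrank ℂ G) → ℂ, L (∑ i, c i • v i) = 0 := by
    intro c
    simp [hLv]
  have hind : LinearIndependent ℂ fun i => B (v i) := by
    rw [Fintype.linearIndependent_iff] at hv ⊢
    intro c hc
    exact hv c (hinj _ (hLs c) (by simpa using hc))
  obtain ⟨e, he⟩ := hL f
  have hspan := hind.span_eq_top_of_card_eq_finrank' (by simp)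
  have hg : g - B e ∈ Submodule.span ℂ (range fun i => B (v i)) := by
    rw [hspan]
    trivial
  obtain ⟨c, hc⟩ := (Submodule.mem_span_range_iff_exists_fun ℂ).1 hg
  refine ⟨e + ∑ i, c i • v i, by rw [map_add, he, hLs, add_zero], ?_⟩
  rw [map_add, map_sum]
  simp only [map_smul, hc]
  abel

/-- In blocks, T(μ)R is close in norm to the triangular operator (f, g) ↦ (f, β f + g), whose
inverse is (f, g) ↦ (f, g - β f). Composing R with that inverse gives `N μ`, an approximate inverse
of T(μ) bounded uniformly in μ. -/
theorem exists_uniform_bound_of_bijective {E F G : Type*} [NormedAddCommGroup E] [NormedSpace ℂ E]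
    [CompleteSpace E] [NormedAddCommGroup F] [NormedSpace ℂ F] [CompleteSpace F]
    [NormedAddCommGroup G] [NormedSpace ℂ G] [FiniteDimensional ℂ G]
    {L : M → E →L[ℂ] F} {B : M → E →L[ℂ] G} {μ₀ : M}
    (hL : Tendsto L (𝓝 μ₀) (𝓝 (L μ₀)))
    (hB : ∀ y, Tendsto (fun μ => B μ y) (𝓝 μ₀) (𝓝 (B μ₀ y)))
    (hinj : ∀ y, L μ₀ y = 0 → B μ₀ y = 0 → y = 0) (hsurj : ∀ f g, ∃ y, L μ₀ y = f ∧ B μ₀ y = g) :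
    ∃ K > 0, ∀ᶠ μ in 𝓝 μ₀, (∀ f g, ∃ y, L μ y = f ∧ B μ y = g) ∧
      (∀ y, ‖y‖ ≤ K * (‖L μ y‖ + ‖B μ y‖)) ∧ ∀ y, ‖L μ y‖ + ‖B μ y‖ ≤ K * ‖y‖ := by
  have : CompleteSpace G := FiniteDimensional.complete ℂ G
  obtain ⟨KB, hKB⟩ := exists_eventually_norm_le hB
  have hKB0 : 0 ≤ KB := (norm_nonneg _).trans hKB.self_of_nhds
  let T₀ : E ≃L[ℂ] F × G := ContinuousLinearEquiv.ofBijective ((L μ₀).prod (B μ₀))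
    (by
      rw [LinearMap.ker_eq_bot']
      intro y hy
      have hy' : (L μ₀ y, B μ₀ y) = 0 := hy
      exact hinj y (congrArg Prod.fst hy') (congrArg Prod.snd hy'))
    (by
      rw [LinearMap.range_eq_top]
      rintro ⟨f, g⟩
      obtain ⟨y, h1, h2⟩ := hsurj f g
      exact ⟨y, Prod.ext h1 h2⟩)
  let R : F × G →L[ℂ] E := T₀.symm
  have hLR : ∀ x, L μ₀ (R x) = x.1 := fun x => congrArg Prod.fst (T₀.apply_symm_apply x)
  have hBR : ∀ x, B μ₀ (R x) = x.2 := fun x => congrArg Prod.snd (T₀.apply_symm_apply x)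
  have hRT : ∀ y, R (L μ₀ y, B μ₀ y) = y := fun y => T₀.symm_apply_apply y
  -- `β μ` tends to 0 strongly but perhaps not in norm, so it is inverted exactly instead of being
  -- treated as small.
  let β : M → F →L[ℂ] G := fun μ => (B μ ∘L R) ∘L ContinuousLinearMap.inl ℂ F G
  let Q : M → F × G →L[ℂ] G := fun μ =>
    ContinuousLinearMap.snd ℂ F G - β μ ∘L ContinuousLinearMap.fst ℂ F G
  let N : M → F × G →L[ℂ] E := fun μ => R ∘L (ContinuousLinearMap.fst ℂ F G).prod (Q μ)
  have hQ : ∀ᶠ μ in 𝓝 μ₀, ∀ x, ‖Q μ x‖ ≤ (1 + KB * ‖R‖) * ‖x‖ := by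
    filter_upwards [hKB] with μ hμ x
    change ‖x.2 - B μ (R (x.1, 0))‖ ≤ _
    have h1 : ‖((x.1, 0) : F × G)‖ ≤ ‖x‖ := by
      rw [Prod.norm_mk, norm_zero, max_eq_left (norm_nonneg _)]
      exact norm_fst_le x
    have h2 : ‖B μ (R (x.1, 0))‖ ≤ KB * (‖R‖ * ‖x‖) :=
      ((B μ).le_of_opNorm_le hμ _).trans
        (mul_le_mul_of_nonneg_left (R.le_opNorm_of_le h1) hKB0)
    linarith [norm_sub_le x.2 (B μ (R (x.1, 0))), norm_snd_le x]
  set c := 1 + KB * ‖R‖ with hc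
  have hc1 : 1 ≤ c := by
    have : 0 ≤ KB * ‖R‖ := by positivity
    linarith
  have hN : ∀ᶠ μ in 𝓝 μ₀, ∀ x, ‖N μ x‖ ≤ (‖R‖ * c) * ‖x‖ := by
    filter_upwards [hQ] with μ hμ x
    change ‖R (x.1, Q μ x)‖ ≤ _
    rw [mul_assoc]
    refine R.le_opNorm_of_le (max_le ?_ (hμ x))
    exact (norm_fst_le x).trans (le_mul_of_one_le_left (norm_nonneg _) hc1)
  -- The error of `N μ` as a right inverse of T(μ). Its second component involves `B μ - B μ₀` only
  -- on R(0, G), which is finite dimensional, so it is small in norm.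
  let D : M → F × G →L[ℂ] F × G := fun μ =>
    ((L μ - L μ₀) ∘L N μ).prod ((((B μ - B μ₀) ∘L R) ∘L ContinuousLinearMap.inr ℂ F G) ∘L Q μ)
  have hTN : ∀ μ x, (L μ (N μ x), B μ (N μ x)) = x + D μ x := by
    intro μ x
    have e1 : L μ₀ (N μ x) = x.1 := hLR (x.1, Q μ x)
    have e2 : N μ x = R (x.1, 0) + R (0, Q μ x) := by
      rw [← map_add]
      change R (x.1, Q μ x) = _
      simp
    have e3 : B μ (R (x.1, 0)) = x.2 - Q μ x := by
      change _ = x.2 - (x.2 - B μ (R (x.1, 0)))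
      abel
    refine Prod.ext ?_ ?_
    · change L μ (N μ x) = x.1 + (L μ (N μ x) - L μ₀ (N μ x))
      rw [e1]
      abel
    · change B μ (N μ x) = x.2 + (B μ (R (0, Q μ x)) - B μ₀ (R (0, Q μ x)))
      rw [e2, map_add, e3, hBR]
      abel
  have hs : Tendsto (fun μ => ‖((B μ - B μ₀) ∘L R) ∘L ContinuousLinearMap.inr ℂ F G‖) (𝓝 μ₀)
      (𝓝 0) := by
    refine tendsto_of_tendsto_apply fun g => ?_
    have := (hB (R (0, g))).sub_const (B μ₀ (R (0, g)))
    simpa using this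
  have hD : ∀ᶠ μ in 𝓝 μ₀, ∀ x, ‖D μ x‖ ≤ 1 / 2 * ‖x‖ := by
    have hLn := tendsto_iff_norm_sub_tendsto_zero.1 hL
    have h1 := (hLn.mul_const (‖R‖ * c))
    have h2 := (hs.mul_const c)
    rw [zero_mul] at h1 h2
    filter_upwards [hN, hQ, h1.eventually_lt_const (by norm_num : (0 : ℝ) < 1 / 2),
      h2.eventually_lt_const (by norm_num : (0 : ℝ) < 1 / 2)] with μ n1 n2 n3 n4 x
    refine max_le ?_ ?_
    · refine ((L μ - L μ₀).le_opNorm_of_le (n1 x)).trans ?_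
      rw [← mul_assoc]
      exact mul_le_mul_of_nonneg_right n3.le (norm_nonneg _)
    · refine ((((B μ - B μ₀) ∘L R) ∘L ContinuousLinearMap.inr ℂ F G).le_opNorm_of_le
        (n2 x)).trans ?_
      rw [← mul_assoc]
      exact mul_le_mul_of_nonneg_right n4.le (norm_nonneg _)
  -- The first summand bounds ‖y‖ by ‖T(μ)y‖; the other two bound `L μ` and `B μ`.
  refine ⟨2 * (‖R‖ * c) + (‖L μ₀‖ + 1) + KB, by positivity, ?_⟩
  have hLb : ∀ᶠ μ in 𝓝 μ₀, ‖L μ‖ ≤ ‖L μ₀‖ + 1 :=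
    (hL.norm.eventually_lt_const (lt_add_one _)).mono fun _ h => h.le
  filter_upwards [hN, hD, hKB, hLb] with μ n1 n2 n3 n4
  refine ⟨fun f g => ?_, fun y => ?_, fun y => ?_⟩
  · have hnorm : ‖-D μ‖ < 1 := by
      rw [norm_neg]
      exact (ContinuousLinearMap.opNorm_le_bound _ (by norm_num) n2).trans_lt (by norm_num)
    have hu := isUnit_one_sub_of_norm_lt_one hnorm
    obtain ⟨x, hx⟩ := (ContinuousLinearMap.isUnit_iff_bijective.1 hu).2 (f, g)
    have hx' : x + D μ x = (f, g) := by
      rw [← hx]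
      simp
    rw [← hTN] at hx'
    exact ⟨N μ x, congrArg Prod.fst hx', congrArg Prod.snd hx'⟩
  -- The preimage of `y` under `N μ`. As T(μ)y = x + D x with ‖D‖ ≤ 1/2, it follows that ‖x‖ ≤
  -- 2‖T(μ)y‖.
  · let x : F × G := (L μ₀ y, B μ₀ y + β μ (L μ₀ y))
    have hNx : N μ x = y := by
      change R (L μ₀ y, B μ₀ y + β μ (L μ₀ y) - β μ (L μ₀ y)) = y
      rw [add_sub_cancel_right, hRT]
    have h1 := hTN μ x
    rw [hNx] at h1
    have h2 : ‖x‖ ≤ ‖(L μ y, B μ y)‖ + 1 / 2 * ‖x‖ := by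
      have h3 : x = (L μ y, B μ y) - D μ x := by
        rw [h1]
        abel
      calc ‖x‖ = ‖(L μ y, B μ y) - D μ x‖ := by rw [← h3]
        _ ≤ _ := (norm_sub_le _ _).trans (add_le_add le_rfl (n2 x))
    have h4 : ‖(L μ y, B μ y)‖ ≤ ‖L μ y‖ + ‖B μ y‖ :=
      max_le (le_add_of_nonneg_right (norm_nonneg _)) (le_add_of_nonneg_left (norm_nonneg _))
    have h5 : ‖x‖ ≤ 2 * (‖L μ y‖ + ‖B μ y‖) := by linarith
    have h6 := n1 x
    rw [hNx] at h6
    refine (h6.trans (mul_le_mul_of_nonneg_left h5 (by positivity))).trans ?_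
    have h7 : 0 ≤ (‖L μ₀‖ + 1 + KB) * (‖L μ y‖ + ‖B μ y‖) := by positivity
    linarith
  · have h1 := (L μ).le_of_opNorm_le n4 y
    have h2 := (B μ).le_of_opNorm_le n3 y
    have h3 : 0 ≤ 2 * (‖R‖ * c) * ‖y‖ := by positivity
    linarith

/-- Continuous maps into normed spaces do not see vectors of seminorm zero, so the problem moves to
the separation quotient of `E` along a linear norm-preserving section `o`. -/
theorem exists_uniform_bound {E F G : Type*} [SeminormedAddCommGroup E] [NormedSpace ℂ E]
    [CompleteSpace E] [NormedAddCommGroup F] [NormedSpace ℂ F] [CompleteSpace F]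
    [NormedAddCommGroup G] [NormedSpace ℂ G] [FiniteDimensional ℂ G]
    {L : M → E →L[ℂ] F} {B : M → E →L[ℂ] G} {μ₀ : M}
    (hL : Tendsto L (𝓝 μ₀) (𝓝 (L μ₀)))
    (hB : ∀ y, Tendsto (fun μ => B μ y) (𝓝 μ₀) (𝓝 (B μ₀ y)))
    (hinj : ∀ y, L μ₀ y = 0 → B μ₀ y = 0 → ‖y‖ = 0) (hsurj : Function.Surjective (L μ₀))
    (v : Fin (Module.finrank ℂ G) → E) (hLv : ∀ i, L μ₀ (v i) = 0)
    (hv : ∀ c : Fin (Module.finrank ℂ G) → ℂ, ‖∑ i, c i • v i‖ = 0 → c = 0) :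
    ∃ K > 0, ∀ᶠ μ in 𝓝 μ₀, (∀ f g, ∃ y, L μ y = f ∧ B μ y = g) ∧
      (∀ y, ‖y‖ ≤ K * (‖L μ y‖ + ‖B μ y‖)) ∧ ∀ y, ‖L μ y‖ + ‖B μ y‖ ≤ K * ‖y‖ := by
  let o : SeparationQuotient E →L[ℂ] E := SeparationQuotient.outCLM ℂ E
  have hmk : ∀ x, SeparationQuotient.mk (o x) = x := SeparationQuotient.mk_outCLM ℂ
  have hins : ∀ y, Inseparable (o (SeparationQuotient.mk y)) y := fun y =>
    SeparationQuotient.mk_eq_mk.1 (hmk _)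
  have hLo : ∀ μ y, L μ (o (SeparationQuotient.mk y)) = L μ y := fun μ y =>
    ((hins y).map (L μ).continuous).eq
  have hBo : ∀ μ y, B μ (o (SeparationQuotient.mk y)) = B μ y := fun μ y =>
    ((hins y).map (B μ).continuous).eq
  have hno : ∀ x, ‖o x‖ = ‖x‖ := fun x => by
    rw [← SeparationQuotient.norm_mk (o x), hmk]
  have hinj' : ∀ x, L μ₀ (o x) = 0 → B μ₀ (o x) = 0 → x = 0 := fun x h1 h2 => by
    rw [← norm_eq_zero, ← hno]
    exact hinj _ h1 h2
  have hsurj' : ∀ f g, ∃ x, L μ₀ (o x) = f ∧ B μ₀ (o x) = g := by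
    refine surjective_prod_of_injective ((L μ₀ ∘L o : SeparationQuotient E →L[ℂ] F) : _ →ₗ[ℂ] F)
      ((B μ₀ ∘L o : SeparationQuotient E →L[ℂ] G) : _ →ₗ[ℂ] G) hinj' ?_
      (fun i => SeparationQuotient.mk (v i)) ?_ ?_
    · intro f
      obtain ⟨y, hy⟩ := hsurj f
      exact ⟨SeparationQuotient.mk y, (hLo _ _).trans hy⟩
    · rw [Fintype.linearIndependent_iff]
      intro c hc
      have h1 : SeparationQuotient.mk (∑ i, c i • v i) = (0 : SeparationQuotient E) := by
        have := map_sum (SeparationQuotient.mkCLM ℂ E) (fun i => c i • v i) Finset.univ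
        refine this.trans (Eq.trans ?_ hc)
        rfl
      rw [← norm_eq_zero, SeparationQuotient.norm_mk] at h1
      exact congrFun (hv c h1)
    · exact fun i => (hLo _ _).trans (hLv i)
  obtain ⟨K, hK, h⟩ := exists_uniform_bound_of_bijective (L := fun μ => L μ ∘L o)
    (B := fun μ => B μ ∘L o) (μ₀ := μ₀)
    (((ContinuousLinearMap.compL ℂ _ E F).flip o).continuous.tendsto _ |>.comp hL)
    (fun y => hB (o y)) hinj' hsurj'
  refine ⟨K, hK, h.mono fun μ ⟨h1, h2, h3⟩ => ⟨fun f g => ?_, fun y => ?_, fun y => ?_⟩⟩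
  · obtain ⟨x, hx⟩ := h1 f g
    exact ⟨o x, hx⟩
  · have := h2 (SeparationQuotient.mk y)
    simpa [hLo, hBo] using this
  · have := h3 (SeparationQuotient.mk y)
    simpa [hLo, hBo] using this

end abstract

/-! ### Global solvability of Lipschitz integral equations. -/

section caratheodory

variable {a b : ℝ}

theorem exists_truncation {α : ℝ → ℝ} (hα : IntegrableOn α (Icc a b)) {ε : ℝ} (hε : 0 < ε) :
    ∃ N : ℝ, 0 < N ∧ ∫ t in Icc a b, max (α t - N) 0 < ε := by
  have hlim : Tendsto (fun k : ℕ => ∫ t in Icc a b, max (α t - k) 0) atTop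
      (𝓝 (∫ _ in Icc a b, (0 : ℝ))) := by
    refine tendsto_integral_of_dominated_convergence (fun t => ‖α t‖) (fun k => ?_) hα.norm
      (fun k => ?_) ?_
    · exact (hα.1.sub aestronglyMeasurable_const).sup aestronglyMeasurable_const
    · refine ae_of_all _ fun t => ?_
      rw [Real.norm_of_nonneg (le_max_right _ _)]
      refine max_le ?_ (norm_nonneg _)
      have h1 : α t ≤ ‖α t‖ := Real.le_norm_self _
      have h2 : (0 : ℝ) ≤ k := Nat.cast_nonneg k
      linarith
    · refine ae_of_all _ fun t => ?_
      refine tendsto_const_nhds.congr' ?_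
      obtain ⟨K, hK⟩ := exists_nat_ge (α t)
      filter_upwards [eventually_ge_atTop K] with k hk
      have h2 : (K : ℝ) ≤ k := Nat.cast_le.2 hk
      rw [max_eq_right (by linarith)]
  rw [integral_zero] at hlim
  obtain ⟨k, h1, h2⟩ := ((hlim.eventually_lt_const hε).and (eventually_gt_atTop 0)).exists
  exact ⟨k, Nat.cast_pos.2 h2, h1⟩

/-- For bounded α a large exponent suffices. In general α ≤ N + (α - N)⁺, where the excess has
integral below 1/4; each part contributes at most a quarter of exp(wt). -/
theorem exists_exp_weight {α : ℝ → ℝ} (hα : IntegrableOn α (Icc a b)) :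
    ∃ w : ℝ, ∀ t ∈ Icc a b,
      ∫ s in a..t, α s * Real.exp (w * s) ≤ 1 / 2 * Real.exp (w * t) := by
  obtain ⟨N, hN, h⟩ := exists_truncation hα (by norm_num : (0 : ℝ) < 1 / 4)
  -- With w = 4N the integral of N exp(ws) is at most exp(wt)/4.
  refine ⟨4 * N, fun t ht => ?_⟩
  have hsub : Icc a t ⊆ Icc a b := Icc_subset_Icc le_rfl ht.2
  have hα2 : IntegrableOn (fun s => max (α s - N) 0) (Icc a b) :=
    (hα.sub (integrableOn_const (by simp))).sup (integrableOn_const (by simp))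
  have he : Continuous fun s : ℝ => Real.exp (4 * N * s) := by fun_prop
  have hii : ∀ {g : ℝ → ℝ}, IntegrableOn g (Icc a b) → IntervalIntegrable g volume a t :=
    fun hg => (intervalIntegrable_iff_integrableOn_Icc_of_le ht.1).2 (hg.mono_set hsub)
  have h1 : ∫ s in a..t, α s * Real.exp (4 * N * s) ≤
      ∫ s in a..t, (N * Real.exp (4 * N * s) + max (α s - N) 0 * Real.exp (4 * N * t)) := by
    refine intervalIntegral.integral_mono_on ht.1
      ((hii hα).mul_continuousOn he.continuousOn)
      (((he.intervalIntegrable _ _).const_mul N).add ((hii hα2).mul_const _)) fun s hs => ?_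
    have e1 : Real.exp (4 * N * s) ≤ Real.exp (4 * N * t) :=
      Real.exp_le_exp.2 (mul_le_mul_of_nonneg_left hs.2 (by positivity))
    have e2 : α s ≤ N + max (α s - N) 0 := by linarith [le_max_left (α s - N) 0]
    have e3 := mul_le_mul_of_nonneg_right e2 (Real.exp_pos (4 * N * s)).le
    have e4 := mul_le_mul_of_nonneg_left e1 (le_max_right (α s - N) 0)
    linarith
  have h2 : ∫ s in a..t, N * Real.exp (4 * N * s) ≤ 1 / 4 * Real.exp (4 * N * t) := by
    have hd : ∀ s ∈ uIcc a t, HasDerivAt (fun s => 1 / 4 * Real.exp (4 * N * s))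
        (N * Real.exp (4 * N * s)) s := by
      intro s _
      have := (((hasDerivAt_id s).const_mul (4 * N)).exp).const_mul (1 / 4)
      convert! this using 1
      simp
      ring
    rw [intervalIntegral.integral_eq_sub_of_hasDerivAt hd
      ((he.intervalIntegrable _ _).const_mul N)]
    linarith [Real.exp_pos (4 * N * a)]
  have h3 : ∫ s in a..t, max (α s - N) 0 ≤ 1 / 4 := by
    rw [intervalIntegral.integral_of_le ht.1]
    refine le_trans ?_ h.le
    exact setIntegral_mono_set hα2 (ae_of_all _ fun _ => le_max_right _ _)
      (Ioc_subset_Icc_self.trans hsub).eventuallyLE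
  rw [intervalIntegral.integral_add ((he.intervalIntegrable _ _).const_mul N)
    ((hii hα2).mul_const _), intervalIntegral.integral_mul_const] at h1
  have h4 := mul_le_mul_of_nonneg_right h3 (Real.exp_pos (4 * N * t)).le
  linarith

/-- Carathéodory's existence theorem: an integral equation whose right-hand side is Lipschitz with
an integrable constant has a continuous solution on the whole interval. -/
theorem exists_caratheodory {V : Type*} [NormedAddCommGroup V] [NormedSpace ℝ V] [CompleteSpace V]
    (hab : a < b) {Φ : ℝ → V → V} {α : ℝ → ℝ} (hα : IntegrableOn α (Icc a b))
    (hα0 : ∀ t, 0 ≤ α t) (hLip : ∀ t u v, ‖Φ t u - Φ t v‖ ≤ α t * ‖u - v‖)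
    (hint : ∀ Y : ℝ → V, Continuous Y → IntegrableOn (fun t => Φ t (Y t)) (Icc a b)) (q : V) :
    ∃ Y : ℝ → V, Continuous Y ∧ ∀ t ∈ Icc a b, Y t = q + ∫ s in a..t, Φ s (Y s) := by
  obtain ⟨w, hw⟩ := exists_exp_weight hα
  -- The unknown is Z(t) = exp(-wt)Y(t). The sup norm of Z is a weighted norm of Y, in which the
  -- Picard map contracts by 1/2 on the whole interval at once.
  let ext : C(Icc a b, V) → ℝ → V := fun Z s => Real.exp (w * s) • Z (projIcc a b hab.le s)
  have hext : ∀ Z, Continuous (ext Z) := fun Z =>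
    (by fun_prop : Continuous fun s : ℝ => Real.exp (w * s)).smul
      (Z.continuous.comp continuous_projIcc)
  have hprim : ∀ Z, ContinuousOn (fun t => q + ∫ s in a..t, Φ s (ext Z s)) (Icc a b) := by
    intro Z
    have := (ac_primitive hab (hint _ (hext Z)) q).continuousOn
    rwa [uIcc_of_le hab.le] at this
  let S : C(Icc a b, V) → C(Icc a b, V) := fun Z =>
    ⟨fun t => Real.exp (-(w * t)) • (q + ∫ s in a..t, Φ s (ext Z s)),
      (by fun_prop : Continuous fun t : Icc a b => Real.exp (-(w * t))).smul
        (continuousOn_iff_continuous_domRestrict.1 (hprim Z))⟩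
  have hS : ContractingWith (1 / 2) S := by
    refine ⟨by rw [← NNReal.coe_lt_coe]; norm_num, LipschitzWith.of_dist_le_mul fun Z Z' => ?_⟩
    rw [dist_eq_norm, dist_eq_norm]
    refine (ContinuousMap.norm_le _ (by positivity)).2 fun t => ?_
    have ht := t.2
    have ha : a ∈ Icc a b := left_mem_Icc.2 hab.le
    have e : (S Z - S Z') t = Real.exp (-(w * t)) •
        ∫ s in a..t, (Φ s (ext Z s) - Φ s (ext Z' s)) := by
      rw [intervalIntegral.integral_sub
        (intervalIntegrable_of_mem (hint _ (hext Z)) ha ht)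
        (intervalIntegrable_of_mem (hint _ (hext Z')) ha ht)]
      change Real.exp (-(w * t)) • (q + _) - Real.exp (-(w * t)) • (q + _) = _
      rw [← smul_sub, add_sub_add_left_eq_sub]
    have hexp : Continuous fun s : ℝ => Real.exp (w * s) := by fun_prop
    have h1 : ‖∫ s in a..t, (Φ s (ext Z s) - Φ s (ext Z' s))‖ ≤
        ∫ s in a..t, α s * Real.exp (w * s) * ‖Z - Z'‖ := by
      refine intervalIntegral.norm_integral_le_of_norm_le ht.1 (ae_of_all _ fun s _ => ?_)
        (((intervalIntegrable_of_mem hα ha ht).mul_continuousOn hexp.continuousOn).mul_const _)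
      refine (hLip s _ _).trans ?_
      have h2 : ‖ext Z s - ext Z' s‖ ≤ Real.exp (w * s) * ‖Z - Z'‖ := by
        rw [← smul_sub, norm_smul, Real.norm_of_nonneg (Real.exp_pos _).le]
        exact mul_le_mul_of_nonneg_left ((Z - Z').norm_coe_le_norm _) (Real.exp_pos _).le
      rw [mul_assoc]
      exact mul_le_mul_of_nonneg_left h2 (hα0 s)
    rw [e, norm_smul, Real.norm_of_nonneg (Real.exp_pos _).le]
    rw [intervalIntegral.integral_mul_const] at h1
    have h4 := mul_le_mul_of_nonneg_right (hw t ht) (norm_nonneg (Z - Z'))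
    calc _ ≤ Real.exp (-(w * t)) * (1 / 2 * Real.exp (w * t) * ‖Z - Z'‖) :=
          mul_le_mul_of_nonneg_left (h1.trans h4) (Real.exp_pos _).le
      _ = (Real.exp (-(w * t)) * Real.exp (w * t)) * (1 / 2 * ‖Z - Z'‖) := by ring
      _ = _ := by
        rw [← Real.exp_add, neg_add_cancel, Real.exp_zero]
        norm_num
  let Z := ContractingWith.fixedPoint S hS
  have hZ : S Z = Z := hS.fixedPoint_isFixedPt
  refine ⟨ext Z, hext Z, fun t ht => ?_⟩
  have h1 : Real.exp (-(w * t)) • (q + ∫ s in a..t, Φ s (ext Z s)) = Z ⟨t, ht⟩ :=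
    DFunLike.congr_fun hZ (⟨t, ht⟩ : Icc a b)
  change Real.exp (w * t) • Z (projIcc a b hab.le t) = _
  rw [projIcc_of_mem hab.le ht, ← h1, smul_smul, ← Real.exp_add, add_neg_cancel, Real.exp_zero,
    one_smul]

end caratheodory

/-! ### Products with a continuous factor. -/

section cauchy

variable {a b : ℝ} {hab : a < b} {n m r : ℕ} {p : ℝ≥0∞}

theorem memLp_mul_of_continuousOn {f g : ℝ → ℂ} (hf : MemLp f p (volume.restrict (Icc a b)))
    (hg : ContinuousOn g (Icc a b)) : MemLp (f * g) p (volume.restrict (Icc a b)) :=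
  MemLp.mul (p := p) (q := ⊤) (r := p) (memLp_of_continuousOn hg) hf

/-- Continuity matters only at k = 0, where L_p is not closed under products; this is where the
regularity bootstrap starts. -/
theorem memSobolev_mul_of_continuousOn (hab : a < b) {k : ℕ} {f g : ℝ → ℂ}
    (hf : MemSobolev a b p k f) (hg : MemSobolev a b p k g) (hgc : ContinuousOn g (Icc a b)) :
    MemSobolev a b p k (f * g) := by
  cases k with
  | zero => exact memLp_mul_of_continuousOn hf hgc
  | succ k => exact hf.mul_self hab hg

end cauchy

/-! ### Reduction to a first-order system. -/

section companion

variable {a b : ℝ} {hab : a < b} {n m r : ℕ} {p : ℝ≥0∞}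

/-- The right-hand side of the first-order system equivalent to `L y = f`. -/
noncomputable def companion (A : Fin r → SobolevSpace hab n p (Fin m × Fin m))
    (f : SobolevSpace hab n p (Fin m)) (t : ℝ) (u : Fin r → Fin m → ℂ) : Fin r → Fin m → ℂ :=
  fun j i => if h : (j : ℕ) + 1 < r then u ⟨j + 1, h⟩ i
    else f t i - ∑ j : Fin r, ∑ l : Fin m, A j t (i, l) * u j l

/-- The 1 covers the rows that merely shift, the sum covers the last row; the resulting Lipschitz
constant is integrable in t. -/
theorem norm_companion_sub_le (A : Fin r → SobolevSpace hab n p (Fin m × Fin m))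
    (f : SobolevSpace hab n p (Fin m)) (t : ℝ) (u v : Fin r → Fin m → ℂ) :
    ‖companion A f t u - companion A f t v‖ ≤
      (1 + ∑ j : Fin r, ∑ q : Fin m × Fin m, ‖A j t q‖) * ‖u - v‖ := by
  have hS : 0 ≤ ∑ j : Fin r, ∑ q : Fin m × Fin m, ‖A j t q‖ :=
    Finset.sum_nonneg fun _ _ => Finset.sum_nonneg fun _ _ => norm_nonneg _
  have hcomp : ∀ j i, ‖u j i - v j i‖ ≤ ‖u - v‖ := fun j i =>
    (norm_le_pi_norm ((u - v) j) i).trans (norm_le_pi_norm (u - v) j)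
  refine (pi_norm_le_iff_of_nonneg (by positivity)).2 fun j =>
    (pi_norm_le_iff_of_nonneg (by positivity)).2 fun i => ?_
  change ‖companion A f t u j i - companion A f t v j i‖ ≤ _
  by_cases h : (j : ℕ) + 1 < r
  · simp only [companion, dif_pos h]
    refine (hcomp _ _).trans (le_mul_of_one_le_left (norm_nonneg _) (by linarith))
  · simp only [companion, dif_neg h, sub_sub_sub_cancel_left, ← Finset.sum_sub_distrib, ← mul_sub]
    have h1 : ‖∑ j : Fin r, ∑ l : Fin m, A j t (i, l) * (v j l - u j l)‖ ≤
        ∑ j : Fin r, ∑ l : Fin m, ‖A j t (i, l)‖ * ‖u - v‖ := by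
      refine (norm_sum_le _ _).trans (Finset.sum_le_sum fun j _ => ?_)
      refine (norm_sum_le _ _).trans (Finset.sum_le_sum fun l _ => ?_)
      rw [norm_mul, norm_sub_rev]
      exact mul_le_mul_of_nonneg_left (hcomp j l) (norm_nonneg _)
    have h2 : ∑ j : Fin r, ∑ l : Fin m, ‖A j t (i, l)‖ ≤
        ∑ j : Fin r, ∑ q : Fin m × Fin m, ‖A j t q‖ := by
      refine Finset.sum_le_sum fun j _ => ?_
      rw [Fintype.sum_prod_type]
      exact Finset.single_le_sum (f := fun i => ∑ l, ‖A j t (i, l)‖)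
        (fun _ _ => Finset.sum_nonneg fun _ _ => norm_nonneg _) (Finset.mem_univ i)
    simp only [← Finset.sum_mul] at h1
    refine h1.trans (mul_le_mul_of_nonneg_right ?_ (norm_nonneg _))
    linarith

theorem memSobolev_companion (A : Fin r → SobolevSpace hab n p (Fin m × Fin m))
    (f : SobolevSpace hab n p (Fin m)) {z : ℝ → Fin r → Fin m → ℂ} {k : ℕ} (hk : k ≤ n)
    (hz : ∀ j i, MemSobolev a b p k fun t => z t j i) (hc : ∀ j i, Continuous fun t => z t j i)
    (j : Fin r) (i : Fin m) : MemSobolev a b p k fun t => companion A f t (z t) j i := by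
  obtain ⟨d, rfl⟩ := Nat.exists_eq_add_of_le hk
  by_cases h : (j : ℕ) + 1 < r
  · simp only [companion, dif_pos h]
    exact hz _ _
  · simp only [companion, dif_neg h]
    have h1 : MemSobolev a b p k (∑ j : Fin r, ∑ l : Fin m,
        (fun t => A j t (i, l)) * fun t => z t j l) :=
      MemSobolev.sum hab _ fun j _ => MemSobolev.sum hab _ fun l _ =>
        memSobolev_mul_of_continuousOn hab (((A j).2 (i, l)).mono_add hab d) (hz j l)
          (hc j l).continuousOn
    convert! ((f.2 i).mono_add hab d).sub hab h1 using 1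
    funext t
    simp [Finset.sum_apply]

theorem exists_companion_solution (hp : 1 ≤ p)
    (A : Fin r → SobolevSpace hab n p (Fin m × Fin m)) (f : SobolevSpace hab n p (Fin m))
    (q : Fin r → Fin m → ℂ) : ∃ z : ℝ → Fin r → Fin m → ℂ, (∀ j i, Continuous fun t => z t j i) ∧
      ∀ j i, ∀ t ∈ Icc a b, z t j i = q j i + ∫ s in a..t, companion A f s (z s) j i := by
  have hA : ∀ j q, IntegrableOn (fun t => A j t q) (Icc a b) := fun j q =>
    MemSobolev.toIntegrableOn hab hp ((A j).2 q)
  have hint : ∀ z : ℝ → Fin r → Fin m → ℂ, Continuous z →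
      IntegrableOn (fun t => companion A f t (z t)) (Icc a b) := by
    intro z hz
    refine integrable_pi_iff.2 fun j => integrable_pi_iff.2 fun i => ?_
    have hc : ∀ j i, Continuous fun t => z t j i := fun j i => by fun_prop
    exact (memSobolev_companion A f (Nat.zero_le n)
      (fun j i => memLp_of_continuousOn (hc j i).continuousOn) hc j i).toIntegrableOn hab hp
  obtain ⟨z, hz, h⟩ := exists_caratheodory hab (Φ := companion A f)
    (α := fun t => 1 + ∑ j : Fin r, ∑ q : Fin m × Fin m, ‖A j t q‖)
    ((integrableOn_const (by simp)).add (integrable_finsetSum _ fun j _ =>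
      integrable_finsetSum _ fun q _ => (hA j q).norm))
    (fun t => by positivity) (norm_companion_sub_le A f) hint q
  refine ⟨z, fun j i => by fun_prop, fun j i t ht => ?_⟩
  have h1 := congrFun (congrFun (h t ht) j) i
  have h2 := ((ContinuousLinearMap.proj (R := ℝ) i : (Fin m → ℂ) →L[ℝ] ℂ) ∘L
    (ContinuousLinearMap.proj j : (Fin r → Fin m → ℂ) →L[ℝ] (Fin m → ℂ))).intervalIntegral_comp_comm
    (intervalIntegrable_of_mem (hint z hz) (left_mem_Icc.2 hab.le) ht)
  refine h1.trans ?_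
  rw [Pi.add_apply, Pi.add_apply]
  congr 1
  exact h2.symm

end companion

/-! ### The Cauchy problem and the kernel of the differential expression. -/

section cauchy

variable {a b : ℝ} {hab : a < b} {n m r : ℕ} {p : ℝ≥0∞}

/-- Solvability of the Cauchy problem for `L y = f` in the Sobolev space. -/
theorem exists_cauchy_solution [Fact (1 ≤ p)] (hr : 1 ≤ r)
    (A : Fin r → SobolevSpace hab n p (Fin m × Fin m)) (f : SobolevSpace hab n p (Fin m))
    (q : Fin r → Fin m → ℂ) : ∃ y : SobolevSpace hab (n + r) p (Fin m),
      ‖diffOp A y - f‖ = 0 ∧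
        ∀ (j : Fin r) i, iteratedDerivWithin j (fun t => y t i) (Icc a b) a = q j i := by
  have hp : 1 ≤ p := Fact.out
  obtain ⟨z, hc, hz⟩ := exists_companion_solution hp A f q
  have ha : a ∈ Icc a b := left_mem_Icc.2 hab.le
  have hza : ∀ j i, z a j i = q j i := fun j i => by
    simpa using hz j i a ha
  have hstep : ∀ {k : ℕ} j i, MemSobolev a b p k (fun t => companion A f t (z t) j i) →
      MemSobolev a b p (k + 1) fun t => z t j i := fun j i h =>
    (memSobolev_primitive hab hp h (q j i)).congr hab fun t ht => (hz j i t ht).symm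
  -- Bootstrap: if z is in W_p^k with k ≤ n, so is the right-hand side, and integration puts z in
  -- W_p^{k+1}. It stops at n + 1 because the coefficients and f have only n derivatives.
  have hreg : ∀ k ≤ n + 1, ∀ j i, MemSobolev a b p k fun t => z t j i := by
    intro k hk
    induction k with
    | zero => exact fun j i => memLp_of_continuousOn (hc j i).continuousOn
    | succ k ih =>
      exact fun j i => hstep j i (memSobolev_companion A f (by omega) (ih (by omega)) hc j i)
  -- Row j is obtained from the last row by d = r - 1 - j further integrations, each gaining a
  -- derivative; row 0 reaches n + r.
  have hreg' : ∀ (d : ℕ) (j : Fin r) (i : Fin m), (j : ℕ) + d + 1 = r →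
      MemSobolev a b p (n + 1 + d) fun t => z t j i := by
    intro d
    induction d with
    | zero => exact fun j i _ => hreg _ le_rfl j i
    | succ d ih =>
      intro j i hj
      refine hstep j i ?_
      have hlt : (j : ℕ) + 1 < r := by omega
      simp only [companion, dif_pos hlt]
      exact ih ⟨j + 1, hlt⟩ i (by simp only; omega)
  have hder : ∀ (k : ℕ) (hk : k < r) (i : Fin m),
      EqOn (iteratedDerivWithin k (fun t => z t ⟨0, hr⟩ i) (Icc a b)) (fun t => z t ⟨k, hk⟩ i)
        (Icc a b) := by
    intro k
    induction k with
    | zero => intro hk i t ht; simp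
    | succ k ih =>
      intro hk i t ht
      have hk' : k < r := by omega
      have e1 : EqOn (iteratedDerivWithin k (fun t => z t ⟨0, hr⟩ i) (Icc a b))
          (fun t => q ⟨k, hk'⟩ i + ∫ s in a..t, z s ⟨k + 1, hk⟩ i) (Icc a b) := by
        intro t ht
        rw [ih hk' i ht]
        have := hz ⟨k, hk'⟩ i t ht
        simpa only [companion, dif_pos hk] using this
      rw [iteratedDerivWithin_succ, derivWithin_congr e1 (e1 ht)]
      exact (hasDerivWithinAt_primitive hab (hc _ _).continuousOn _ ht).derivWithin
        (uniqueDiffOn_Icc hab t ht)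
  let y : SobolevSpace hab (n + r) p (Fin m) := ⟨fun t i => z t ⟨0, hr⟩ i, fun i => by
    have := hreg' (r - 1) ⟨0, hr⟩ i (by simp only; omega)
    rwa [show n + 1 + (r - 1) = n + r by omega] at this⟩
  refine ⟨y, ?_, fun j i => (hder j j.2 i ha).trans (hza j i)⟩
  rw [SobolevSpace.norm_sub_eq_zero_iff]
  intro i
  obtain ⟨R, rfl⟩ := Nat.exists_eq_add_of_le' hr
  have hR : ¬ R + 1 < R + 1 := lt_irrefl _
  -- The last row is a primitive of f - ∑ A_j y^(j), so differentiating it gives the equation,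
  -- almost everywhere.
  have e1 : EqOn (iteratedDerivWithin R (fun t => y t i) (Icc a b))
      (fun t => q ⟨R, R.lt_succ_self⟩ i +
        ∫ s in a..t, companion A f s (z s) ⟨R, R.lt_succ_self⟩ i) (Icc a b) := fun t ht =>
    (hder R R.lt_succ_self i ht).trans (hz ⟨R, R.lt_succ_self⟩ i t ht)
  have hm := memSobolev_companion A f (Nat.zero_le n)
      (fun j i => hreg 0 (Nat.zero_le _) j i) hc ⟨R, R.lt_succ_self⟩ i
  filter_upwards [derivWithin_primitive_ae hab (hm.toIntegrableOn hab hp) (q ⟨R, R.lt_succ_self⟩ i),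
    ae_restrict_mem measurableSet_Icc] with t h1 ht
  rw [diffOp_apply, iteratedDerivWithin_succ, derivWithin_congr e1 (e1 ht), h1]
  have h2 : ∀ (j : Fin (R + 1)) l, iteratedDerivWithin j (fun τ => y τ l) (Icc a b) t = z t j l :=
    fun j l => hder j j.2 l ht
  simp only [companion, dif_neg hR, h2]
  ring

/-- The initial data `y^(j)(a)`, `j < r`, as a linear map. -/
noncomputable def initialData (hab : a < b) (n m r : ℕ) (p : ℝ≥0∞) :
    SobolevSpace hab (n + r) p (Fin m) →ₗ[ℂ] Fin r → Fin m → ℂ where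
  toFun y j i := iteratedDerivWithin j (fun t => y t i) (Icc a b) a
  map_add' y z := by
    funext j i
    have ha : a ∈ Icc a b := left_mem_Icc.2 hab.le
    have hd : ∀ w : SobolevSpace hab (n + r) p (Fin m),
        ContDiffWithinAt ℝ (j : ℕ) (fun t => w t i) (Icc a b) a := by
      intro w
      have hw : MemSobolev a b p ((j : ℕ) + 1 + (n + r - (j + 1))) fun t => w t i := by
        rw [show (j : ℕ) + 1 + (n + r - (j + 1)) = n + r by omega]
        exact w.2 i
      exact (hw.mono_add hab).1 a ha
    exact iteratedDerivWithin_add ha (uniqueDiffOn_Icc hab) (hd y) (hd z)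
  map_smul' c y := by
    funext j i
    exact congrFun (iteratedDerivWithin_smul_all j c fun τ => y τ i) a

theorem initialData_eq_zero [Fact (1 ≤ p)] (hr : 1 ≤ r) (y : SobolevSpace hab (n + r) p (Fin m))
    (hy : ‖y‖ = 0) : initialData hab n m r p y = 0 := by
  rw [← sub_zero y, SobolevSpace.norm_sub_eq_zero_iff_eqOn (by omega)] at hy
  funext j i
  have h : EqOn (fun t => y t i) (0 : ℝ → ℂ) (Icc a b) := fun t ht => congrFun (hy t ht) i
  refine (iteratedDerivWithin_congr h (left_mem_Icc.2 hab.le)).trans ?_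
  simp

/-- Solutions of the homogeneous equation with unit initial data. A combination of seminorm zero has
zero initial data, which are its coefficients. -/
theorem exists_kernel_family [Fact (1 ≤ p)] (hr : 1 ≤ r)
    (A : Fin r → SobolevSpace hab n p (Fin m × Fin m)) :
    ∃ v : Fin (r * m) → SobolevSpace hab (n + r) p (Fin m), (∀ i, diffOpL A (v i) = 0) ∧
      ∀ c : Fin (r * m) → ℂ, ‖∑ i, c i • v i‖ = 0 → c = 0 := by
  choose S hS hSq using exists_cauchy_solution (p := p) hr A (0 : SobolevSpace hab n p (Fin m))
  let e : Fin (r * m) → Fin r → Fin m → ℂ := fun i j l =>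
    if finProdFinEquiv (j, l) = i then 1 else 0
  refine ⟨fun i => S (e i), fun i => ?_, fun c hc => ?_⟩
  · rw [diffOpL_apply, ← norm_eq_zero, SeparationQuotient.norm_mk, ← sub_zero (diffOp A _)]
    exact hS _
  · have h := initialData_eq_zero hr _ hc
    have hSe : ∀ i, initialData hab n m r p (S (e i)) = e i := fun i =>
      funext fun j => funext fun l => hSq (e i) j l
    simp only [map_sum, map_smul, hSe] at h
    funext i
    obtain ⟨⟨j, l⟩, rfl⟩ := finProdFinEquiv.surjective i
    have h1 := congrFun (congrFun h j) l
    simpa [Finset.sum_apply, e] using h1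

end cauchy

end BVP

/-! ### The main theorem. -/

open BVP

theorem mainTheorem5 {M : Type*} [MetricSpace M] {a b : ℝ} (hab : a < b)
    (n m r : ℕ) (hm : 1 ≤ m) (hr : 1 ≤ r) (p : ℝ≥0∞) [Fact (1 ≤ p)]
    (A : M → Fin r → SobolevSpace hab n p (Fin m × Fin m))
    (B : M → SobolevSpace hab (n + r) p (Fin m) →L[ℂ] CVec (r * m))
    (μ₀ : M)
    (h0 : ConditionZero (A μ₀) (B μ₀))
    (hI : LimitConditionI A μ₀) (hII : LimitConditionII B μ₀) :
    ∃ ε > (0 : ℝ), ∃ γ₁ > (0 : ℝ), ∃ γ₂ > (0 : ℝ),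
      ∀ (f : M → SobolevSpace hab n p (Fin m)) (c : M → CVec (r * m)),
        ∀ μ ∈ Metric.ball μ₀ ε,
          (∃ y, IsSolution (A μ) (B μ) (f μ) (c μ) y ∧
            ∀ z, IsSolution (A μ) (B μ) (f μ) (c μ) z → ∀ t ∈ Icc a b, z t = y t) ∧
          ∀ y₀ y : SobolevSpace hab (n + r) p (Fin m),
            IsSolution (A μ₀) (B μ₀) (f μ₀) (c μ₀) y₀ →
            IsSolution (A μ) (B μ) (f μ) (c μ) y →
              γ₁ * discrepancy (A μ) (B μ) (f μ) (c μ) y₀ ≤ ‖y₀ - y‖ ∧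
              ‖y₀ - y‖ ≤ γ₂ * discrepancy (A μ) (B μ) (f μ) (c μ) y₀ := by
  have hnr : 1 ≤ n + r := by omega
  have hsol : ∀ (A : Fin r → SobolevSpace hab n p (Fin m × Fin m))
      (B : SobolevSpace hab (n + r) p (Fin m) →L[ℂ] CVec (r * m))
      (f : SobolevSpace hab n p (Fin m)) (c : CVec (r * m))
      (y : SobolevSpace hab (n + r) p (Fin m)),
      IsSolution A B f c y ↔ diffOpL A y = SeparationQuotient.mk f ∧ B y = c := by
    intro A B f c y
    rw [isSolution_iff, diffOpL_apply, ← sub_eq_zero (a := SeparationQuotient.mk (diffOp A y)),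
      ← norm_eq_zero (a := SeparationQuotient.mk (diffOp A y) - SeparationQuotient.mk f),
      ← SeparationQuotient.mk_sub, SeparationQuotient.norm_mk]
  have hfin : Module.finrank ℂ (CVec (r * m)) = r * m := by
    rw [LinearEquiv.finrank_eq (WithLp.linearEquiv 1 ℂ (Fin (r * m) → ℂ))]
    simp
  obtain ⟨v, hLv, hv⟩ := exists_kernel_family hr (A μ₀)
  obtain ⟨K, hK, hev⟩ := exists_uniform_bound (L := fun μ => diffOpL (A μ)) (B := B) (μ₀ := μ₀)
    (tendsto_diffOpL hI) hII (fun y h1 h2 => by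
      have h := h0 y ((hsol _ _ _ _ _).2 ⟨h1, h2⟩)
      rw [← sub_zero y, SobolevSpace.norm_sub_eq_zero_iff_eqOn hnr]
      exact h)
    (fun f => by
      obtain ⟨f, rfl⟩ := SeparationQuotient.surjective_mk f
      obtain ⟨y, hy, -⟩ := exists_cauchy_solution hr (A μ₀) f 0
      refine ⟨y, ?_⟩
      rw [diffOpL_apply, ← sub_eq_zero, ← norm_eq_zero, ← SeparationQuotient.mk_sub,
        SeparationQuotient.norm_mk, hy])
    (fun i => v (Fin.cast hfin i)) (fun i => hLv _) (fun c hc => by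
      have h1 := hv (fun i => c (Fin.cast hfin.symm i)) (by
        rw [← hc]
        congr 1
        exact Fintype.sum_equiv (finCongr hfin.symm) _ _ fun i => by simp)
      funext i
      simpa using congrFun h1 (Fin.cast hfin i))
  obtain ⟨ε, hε, hball⟩ := Metric.eventually_nhds_iff_ball.1 hev
  -- `K` was found from the operators alone, before `f`, `c` and the solutions enter.
  refine ⟨ε, hε, K⁻¹, inv_pos.2 hK, K, hK, fun f c μ hμ => ?_⟩
  obtain ⟨hex, hlow, hup⟩ := hball μ hμ
  refine ⟨?_, fun y₀ y _ hy => ?_⟩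
  · obtain ⟨y, hy⟩ := hex (SeparationQuotient.mk (f μ)) (c μ)
    refine ⟨y, (hsol _ _ _ _ _).2 hy, fun z hz => ?_⟩
    rw [hsol] at hz
    rw [← SobolevSpace.norm_sub_eq_zero_iff_eqOn hnr]
    refine le_antisymm ((hlow _).trans (le_of_eq ?_)) (norm_nonneg _)
    rw [map_sub, map_sub, hz.1, hz.2, hy.1, hy.2]
    simp
  · rw [hsol] at hy
    -- Only the equation for `y` is needed: it replaces f(μ) and c(μ) by L(μ)y and B(μ)y, and
    -- linearity does the rest.
    have hd : discrepancy (A μ) (B μ) (f μ) (c μ) y₀ =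
        ‖diffOpL (A μ) (y₀ - y)‖ + ‖B μ (y₀ - y)‖ := by
      rw [map_sub, map_sub, hy.1, hy.2, diffOpL_apply, ← SeparationQuotient.mk_sub,
        SeparationQuotient.norm_mk]
      rfl
    rw [hd]
    exact ⟨(inv_mul_le_iff₀ hK).2 (hup _), hlow _⟩
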